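/- **Conventions.** Filtrations are indexed by the non-positive integers $\mathbb Z_-=\{n\in\mathbb Z: n\le 0\}$ or by an infinite subset $D$ of $\mathbb Z_-$; all sub-$\sigma$-fields of a probability space are taken complete and essentially separable, and $\mathcal F^Z_n=\sigma(Z_k: k\le n)$ (completed). A filtration is *of product type* if it is the natural filtration of a process of independent random variables. $\mathcal F$ is *immersed* into $\mathcal G$ if for every $n$, $\mathcal F_n\subset\mathcal G_n$ and $\mathcal F_n$ is independent of $\mathcal G_{m}$ conditionally on $\mathcal F_{m}$, where $m$ is the predecessor of $n$ in the index set (equivalently, for all $m\le n$ in the index set). An *isomorphism* between filtered probability spaces is a bijection from $L^0(\mathcal F_\infty)$ onto $L^0(\mathcal F'_\infty)$ which preserves laws, commutes with Borel functions of sequences of random variables, and sends $\mathcal F$ on $\mathcal F'$. A filtration is *standard* if some isomorphic copy of it, on some probability space, is immersed into a product-type filtration. A filtration $(\mathcal F_n)_{n\le 0}$ is *at the threshold of standardness* if it is not standard and, for every infinite $B\subset\mathbb Z_-$, $(\mathcal F_n)_{n\in B}$ is standard if and only if $\mathbb Z_-\setminus B$ is infinite. It is *$(r_n)_{n\le 0}$-adic*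 if for every $n\le 0$, $\mathcal F_n$ is generated by $\mathcal F_{n-1}$ and a random variable independent of $\mathcal F_{n-1}$ and uniform on a set of $r_n$ elements. A triple $(Z_0,Z_1,Z_2)$ of random variables, uniform on finite sets $F_0,F_1,F_2$, is a *strong $(r_1,r_2)$-adic $\alpha$-brick* (with $r_1,r_2$ positive integers) if: $Z_0$ and $Z_2$ are independent; $Z_1$ is almost surely a deterministic function of $(Z_0,Z_2)$; $Z_0$ is almost surely a deterministic function of $Z_1$; the conditional law of $Z_1$ given $Z_0$ (respectively of $Z_2$ given $Z_1$) is uniform on a random set of size $r_1$ (respectively $r_2$); and for all distinct $z',z''\in F_1$, $$\sum_{z\in F_2}\min\big(\mathbb P[Z_2=z\mid Z_1=z'],\ \mathbb P[Z_2=z\mid Z_1=z'']\big)\le\alpha .$$ **Theorem.** Let $(\alpha_n)_{n\le 0}$ be a sequence in $]0,1[$ such that $\sum_{n\le 0}\alpha_n<\infty$, let $(r_n)_{n\le 0}$ be a sequence of positive integers, and let $(Z_n)_{n\le 0}$ be random variables on a probability space with values in finite sets $(F_n)_{n\le 0}$ of size at least $2$. Assume that the random variables $(Z_{2n})_{n\le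 0}$ are independent and that for each $n\le 0$, $(Z_{2n-2},Z_{2n-1},Z_{2n})$ is a strong $(r_{2n-1},r_{2n})$-adic $\alpha_n$-brick. Then: 1. $(Z_n)_{n\le 0}$ is an (inhomogeneous) Markov process and its natural filtration $\mathcal F^Z$ is $(r_n)_{n\le 0}$-adic; 2. for every infinite subset $D$ of $\mathbb Z_-$, the filtration $(\mathcal F^Z_n)_{n\in D}$ is standard if and only if $2n-1\notin D$ for infinitely many $n\le 0$; 3. in particular, $(\mathcal F^Z_{2n-1})_{n\le 0}$ is at the threshold of standardness. -/

import Mathlib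

open MeasureTheory ProbabilityTheory Filter Set

noncomputable section

namespace BackwardFiltration

universe u

/-- The completion of a sub-σ-field `m` inside the probability space `(Ω, mΩ, μ)`: the events of
`mΩ` that are almost surely equal to an event of `m`. -/
@[reducible] def completed {Ω : Type*} {mΩ : MeasurableSpace Ω} (μ : Measure Ω) (m : MeasurableSpace Ω) :
    MeasurableSpace Ω :=
  eventuallyMeasurableSpace m (ae μ) ⊓ mΩ

theorem completed_mono {Ω : Type*} {mΩ : MeasurableSpace Ω} (μ : Measure Ω)
    {m₁ m₂ : MeasurableSpace Ω} (h : m₁ ≤ m₂) : completed μ m₁ ≤ completed μ m₂ := by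
  refine inf_le_inf_right _ ?_
  rintro s ⟨t, ht, hst⟩
  exact ⟨t, h t ht, hst⟩

/-- The (completed) natural filtration `n ↦ σ(Z k : k ≤ n)` of a process `Z`. -/
def naturalFiltration {Ω ι : Type*} [Preorder ι] {mΩ : MeasurableSpace Ω} (μ : Measure Ω)
    {E : ι → Type*} [∀ n, MeasurableSpace (E n)] (Z : ∀ n, Ω → E n) : Filtration ι mΩ where
  seq n := completed μ (⨆ k : Set.Iic n, MeasurableSpace.comap (Z k) inferInstance)
  mono' _ _ hmn := completed_mono μ <| iSup_le fun k =>
    le_iSup_of_le (⟨k.1, k.2.trans hmn⟩ : Set.Iic _) le_rfl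
  le' _ := inf_le_right

/-- The filtration `i ↦ ℱ (φ i)` obtained from `ℱ` by a monotone change of time `φ`. -/
def reindex {Ω ι κ : Type*} [Preorder ι] [Preorder κ] {mΩ : MeasurableSpace Ω}
    (ℱ : Filtration ι mΩ) (φ : κ → ι) (hφ : Monotone φ) : Filtration κ mΩ where
  seq i := ℱ (φ i)
  mono' _ _ hij := ℱ.mono (hφ hij)
  le' i := ℱ.le (φ i)

/-- The extracted filtration `(ℱ n)_{n ∈ D}`. -/
def extract {Ω ι : Type*} [Preorder ι] {mΩ : MeasurableSpace Ω}
    (ℱ : Filtration ι mΩ) (D : Set ι) : Filtration D mΩ :=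
  reindex ℱ (fun n : D => (n : ι)) (fun _ _ h => h)

/-- The filtration `(ℱ (2n-1))_{n ≤ 0}` extracted at the odd negative times. -/
def oddTimes {Ω : Type*} {mΩ : MeasurableSpace Ω} (ℱ : Filtration ℤ mΩ) :
    Filtration (Set.Iic (0 : ℤ)) mΩ :=
  reindex ℱ (fun n : Set.Iic (0 : ℤ) => 2 * (n : ℤ) - 1) (fun a b h => by
    have h' : (a : ℤ) ≤ b := h
    show 2 * (a : ℤ) - 1 ≤ 2 * (b : ℤ) - 1
    omega)

/-- A filtration is of product type if it is the natural filtration of a process of independent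
random variables. (Real-valued random variables generate all essentially separable σ-fields.) -/
def IsProductType {Ω ι : Type*} [Preorder ι] {mΩ : MeasurableSpace Ω} (μ : Measure Ω)
    (𝒢 : Filtration ι mΩ) : Prop :=
  ∃ V : ι → Ω → ℝ, (∀ n, Measurable (V n)) ∧ iIndepFun V μ ∧ 𝒢 = naturalFiltration μ V

/-- `ℱ` is immersed into `𝒢`: `ℱ n ⊆ 𝒢 n` for every `n`, and for `m ≤ n` the σ-fields `ℱ n` and
`𝒢 m` are independent conditionally on `ℱ m`. (In discrete time it is equivalent to require this
only when `m` is the predecessor of `n`.) -/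
def Immersed {Ω ι : Type*} [Preorder ι] {mΩ : MeasurableSpace Ω} (μ : Measure Ω)
    (ℱ 𝒢 : Filtration ι mΩ) : Prop :=
  (∀ n, ℱ n ≤ 𝒢 n) ∧
    ∀ m n, m ≤ n → ∀ A B : Set Ω, MeasurableSet[ℱ n] A → MeasurableSet[𝒢 m] B →
      μ[(A ∩ B).indicator (fun _ => (1 : ℝ)) | ℱ m] =ᵐ[μ]
        μ[A.indicator (fun _ => (1 : ℝ)) | ℱ m] * μ[B.indicator (fun _ => (1 : ℝ)) | ℱ m]

/-- `L⁰(Ω, m, μ)`: the classes modulo `μ` of the `m`-measurable real random variables. -/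
def L0 {Ω : Type*} {mΩ : MeasurableSpace Ω} (μ : Measure Ω) :
    MeasurableSpace Ω → Set (Ω →ₘ[μ] ℝ) :=
  fun m => {X | AEStronglyMeasurable[m] X μ}

/-- Isomorphisms of filtered probability spaces: bijections from `L⁰(ℱ_∞)` onto `L⁰(ℱ'_∞)` which
preserve the laws, commute with Borel functions of sequences of random variables, and send `ℱ`
on `ℱ'`. -/
structure FilteredIso {Ω Ω' ι : Type*} [Preorder ι] {mΩ : MeasurableSpace Ω}
    {mΩ' : MeasurableSpace Ω'} (μ : Measure Ω) (ℱ : Filtration ι mΩ)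
    (μ' : Measure Ω') (ℱ' : Filtration ι mΩ') where
  toEquiv : L0 μ (⨆ n, ℱ n) ≃ L0 μ' (⨆ n, ℱ' n)
  map_law : ∀ X, μ'.map ((toEquiv X : Ω' →ₘ[μ'] ℝ) : Ω' → ℝ) = μ.map ((X : Ω →ₘ[μ] ℝ) : Ω → ℝ)
  map_borel : ∀ (X : ℕ → L0 μ (⨆ n, ℱ n)) (Y : L0 μ (⨆ n, ℱ n)) (g : (ℕ → ℝ) → ℝ), Measurable g →
    (Y : Ω →ₘ[μ] ℝ) =ᵐ[μ] (fun ω => g fun k => (X k : Ω →ₘ[μ] ℝ) ω) →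
    (toEquiv Y : Ω' →ₘ[μ'] ℝ) =ᵐ[μ'] (fun ω => g fun k => (toEquiv (X k) : Ω' →ₘ[μ'] ℝ) ω)
  map_filtration : ∀ n X, (toEquiv X : Ω' →ₘ[μ'] ℝ) ∈ L0 μ' (ℱ' n) ↔
    (X : Ω →ₘ[μ] ℝ) ∈ L0 μ (ℱ n)

/-- A filtration is standard if it is immersible into a product-type filtration: some filtration
isomorphic to it, on some probability space, is immersed into a product-type filtration. -/
def IsStandard {Ω : Type u} {ι : Type*} [Preorder ι] {mΩ : MeasurableSpace Ω} (μ : Measure Ω)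
    (ℱ : Filtration ι mΩ) : Prop :=
  ∃ (Ω' : Type u) (mΩ' : MeasurableSpace Ω') (μ' : Measure Ω') (ℱ' 𝒢 : Filtration ι mΩ'),
    IsProbabilityMeasure μ' ∧ IsProductType μ' 𝒢 ∧ Nonempty (FilteredIso μ ℱ μ' ℱ') ∧
      Immersed μ' ℱ' 𝒢

/-- A filtration indexed by the non-positive integers is at the threshold of standardness if it is
not standard, and its infinite extractions are standard exactly when infinitely many times are
skipped. -/
def AtThreshold {Ω : Type*} {mΩ : MeasurableSpace Ω} (μ : Measure Ω)
    (ℱ : Filtration (Set.Iic (0 : ℤ)) mΩ) : Prop :=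
  ¬ IsStandard μ ℱ ∧
    ∀ B : Set (Set.Iic (0 : ℤ)), B.Infinite → (IsStandard μ (extract ℱ B) ↔ Bᶜ.Infinite)

/-- `(ℱ n)_{n ≤ 0}` is `(r n)`-adic: for every `n ≤ 0`, `ℱ n` is generated by `ℱ (n-1)` and a
random variable which is independent of `ℱ (n-1)` and uniform on a set with `r n` elements. -/
def IsAdicFiltration {Ω : Type*} {mΩ : MeasurableSpace Ω} (μ : Measure Ω) (ℱ : Filtration ℤ mΩ)
    (r : ℤ → ℕ) : Prop :=
  ∀ n ≤ 0, ∃ U : Ω → Fin (r n), Measurable U ∧ (∀ i, μ.real (U ⁻¹' {i}) = 1 / (r n : ℝ)) ∧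
    Indep (ℱ (n - 1)) (MeasurableSpace.comap U inferInstance) μ ∧
    ℱ n = completed μ (ℱ (n - 1) ⊔ MeasurableSpace.comap U inferInstance)

/-- `(Z n)_{n ≤ 0}` is an (inhomogeneous) Markov process: for every `n ≤ 0`, the conditional law of
`Z n` given the past up to time `n - 1` is its conditional law given `Z (n-1)`. -/
def IsMarkov {Ω : Type*} {mΩ : MeasurableSpace Ω} (μ : Measure Ω)
    {E : ℤ → Type*} [∀ n, MeasurableSpace (E n)] (Z : ∀ n, Ω → E n) : Prop :=
  ∀ n ≤ 0, ∀ A : Set (E n), MeasurableSet A →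
    μ[(Z n ⁻¹' A).indicator (fun _ => (1 : ℝ)) | naturalFiltration μ Z (n - 1)] =ᵐ[μ]
      μ[(Z n ⁻¹' A).indicator (fun _ => (1 : ℝ)) |
        MeasurableSpace.comap (Z (n - 1)) inferInstance]

/-- The random variable `Z` is uniform on the finite set `E`. -/
def IsUniform {Ω : Type*} {mΩ : MeasurableSpace Ω} (μ : Measure Ω) {E : Type*} [Fintype E]
    (Z : Ω → E) : Prop :=
  ∀ z, μ.real (Z ⁻¹' {z}) = 1 / (Fintype.card E : ℝ)

/-- The conditional probability `P[Y = y | X = x]`. -/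
def condProb {Ω : Type*} {mΩ : MeasurableSpace Ω} (μ : Measure Ω) {E E' : Type*}
    (Y : Ω → E') (X : Ω → E) (y : E') (x : E) : ℝ :=
  (μ[|X ⁻¹' {x}]).real (Y ⁻¹' {y})

/-- The conditional law of `Y` given `X` is uniform on a (random) set of size `r`. -/
def CondUniform {Ω : Type*} {mΩ : MeasurableSpace Ω} (μ : Measure Ω) {E E' : Type*}
    (Y : Ω → E') (X : Ω → E) (r : ℕ) : Prop :=
  ∃ S : E → Finset E', ∀ x, (S x).card = r ∧
    (∀ y ∈ S x, condProb μ Y X y x = 1 / (r : ℝ)) ∧ ∀ y ∉ S x, condProb μ Y X y x = 0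

/-- `(Z₀, Z₁, Z₂)` is a strong `(r₁, r₂)`-adic `α`-brick. -/
structure IsStrongBrick {Ω : Type*} {mΩ : MeasurableSpace Ω} (μ : Measure Ω)
    {E₀ E₁ E₂ : Type*} [Fintype E₀] [Fintype E₁] [Fintype E₂]
    [MeasurableSpace E₀] [MeasurableSpace E₁] [MeasurableSpace E₂]
    (Z₀ : Ω → E₀) (Z₁ : Ω → E₁) (Z₂ : Ω → E₂) (r₁ r₂ : ℕ) (α : ℝ) : Prop where
  pos₁ : 0 < r₁
  pos₂ : 0 < r₂
  uniform₀ : IsUniform μ Z₀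
  uniform₁ : IsUniform μ Z₁
  uniform₂ : IsUniform μ Z₂
  indep : IndepFun Z₀ Z₂ μ
  eq_fun₁ : ∃ g : E₀ → E₂ → E₁, ∀ᵐ ω ∂μ, Z₁ ω = g (Z₀ ω) (Z₂ ω)
  eq_fun₀ : ∃ f : E₁ → E₀, ∀ᵐ ω ∂μ, Z₀ ω = f (Z₁ ω)
  cond₁ : CondUniform μ Z₁ Z₀ r₁
  cond₂ : CondUniform μ Z₂ Z₁ r₂
  overlap : ∀ z' z'' : E₁, z' ≠ z'' →
    ∑ z : E₂, min (condProb μ Z₂ Z₁ z z') (condProb μ Z₂ Z₁ z z'') ≤ α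

end BackwardFiltration

end

namespace BackwardFiltration

/-! ### Completed sub-σ-fields -/

section Completion

variable {Ω : Type*} {mΩ : MeasurableSpace Ω} {μ : Measure Ω}

/-! Each odd value is a function of its two even neighbours, and the even values are independent.
Given `Z (2n-2) = x`, `Z (2n-1)` is a function of `Z (2n)`, which is independent of the past. Given
`Z (2n-1)`, the value `Z (2n-2)` is known, so what is left of the past goes back to time `2n-4` and
is independent of `(Z (2n-2), Z (2n))`. Both facts give the Markov property (`exists_transition`).
Since the conditional supports have fixed sizes, numbering their points turns each step into a
uniform innovation (`exists_innovation`).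

Standard case: let the times `2n-1` be skipped for infinitely many `n`. At such an `n`, the step
from `2n-2` to `2n` can use `Z (2n)` itself as innovation, as it is independent of the past. The
chain then restarts from `Z (2n)` with no memory. Such restarts occur arbitrarily far back, so the
innovations generate the extracted filtration, which is of product type
(`exists_independent_innovations`, `isProductType_reindex`).

Non-standard case: all odd times before some time are kept. The odd values, read backwards, form an
`IsBackwardChain`: `X k` determines the even value `f k (X k)` just before it, and the laws of this
even value given distinct values of `X (k+1)` have overlaps with small sum. This structure passes
through isomorphisms and immersions, so standardness would put it on a space of independent
coordinates. There, take two paths with independent pasts up to time `j n` and a common future.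
Their values of `X n` differ with probability at least 1/2, as no atom exceeds 1/2. If the values of
`X (k+1)` differ, those of `X k` can agree only if the even values in between do; any joint law of
these two variables allows this with probability at most the overlap `ε k` (`real_coupled_step`).
With a total overlap of at most 1/4, the values of `X 0` differ with probability at least 1/4,
whatever `n` is. But `X 0` is approximated by events depending on finitely many coordinates, which
both paths share when `j n` is far in the past (`exists_real_ne_copies_lt`): a contradiction. -/

theorem measurableSet_completed_iff {m : MeasurableSpace Ω} {s : Set Ω} :
    MeasurableSet[completed μ m] s ↔
      (∃ t, MeasurableSet[m] t ∧ s =ᵐ[μ] t) ∧ MeasurableSet[mΩ] s :=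
  MeasurableSpace.measurableSet_inf

theorem le_completed {m : MeasurableSpace Ω} (hm : m ≤ mΩ) : m ≤ completed μ m :=
  le_inf le_eventuallyMeasurableSpace hm

theorem completed_le_completed {m₁ m₂ : MeasurableSpace Ω} (h : m₁ ≤ completed μ m₂) :
    completed μ m₁ ≤ completed μ m₂ := by
  intro s hs
  obtain ⟨⟨t, ht, hst⟩, hs⟩ := measurableSet_completed_iff.1 hs
  obtain ⟨⟨u, hu, htu⟩, -⟩ := measurableSet_completed_iff.1 (h t ht)
  exact measurableSet_completed_iff.2 ⟨⟨u, hu, hst.trans htu⟩, hs⟩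

theorem measurableSet_completed_of_ae_eq {m : MeasurableSpace Ω} {s t : Set Ω}
    (ht : MeasurableSet[completed μ m] t) (hs : MeasurableSet[mΩ] s) (hst : s =ᵐ[μ] t) :
    MeasurableSet[completed μ m] s := by
  obtain ⟨⟨u, hu, htu⟩, -⟩ := measurableSet_completed_iff.1 ht
  exact measurableSet_completed_iff.2 ⟨⟨u, hu, hst.trans htu⟩, hs⟩

theorem comap_le_completed_of_ae_eq {m : MeasurableSpace Ω} {E : Type*} [MeasurableSpace E]
    {X Y : Ω → E} (hX : Measurable[mΩ] X) (hY : Measurable[completed μ m] Y) (h : X =ᵐ[μ] Y) :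
    MeasurableSpace.comap X inferInstance ≤ completed μ m := by
  rintro s ⟨t, ht, rfl⟩
  exact measurableSet_completed_of_ae_eq (hY ht) (hX ht) (h.preimage t)

theorem Indep.completed_left {m₁ m₂ : MeasurableSpace Ω} (h : Indep m₁ m₂ μ) :
    Indep (completed μ m₁) m₂ μ := by
  rw [Indep_iff] at h ⊢
  intro s t hs ht
  obtain ⟨⟨u, hu, hsu⟩, -⟩ := measurableSet_completed_iff.1 hs
  rw [measure_congr (hsu.inter (ae_eq_refl t)), measure_congr hsu, h u t hu ht]

theorem naturalFiltration_apply {ι : Type*} [Preorder ι] {E : ι → Type*}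
    [∀ n, MeasurableSpace (E n)] (Z : ∀ n, Ω → E n) (n : ι) :
    naturalFiltration μ Z n =
      completed μ (⨆ k : Set.Iic n, MeasurableSpace.comap (Z k) inferInstance) := rfl

end Completion

/-! ### Independence along a linear order, real codes of finite variables -/

section Independence

variable {Ω : Type*} {mΩ : MeasurableSpace Ω} {μ : Measure Ω}

/-- A linearly ordered family of σ-fields is independent if each one is independent of the
σ-field generated by the preceding ones. -/
theorem iIndep_of_indep_iSup_lt [IsProbabilityMeasure μ] {ι : Type*} [LinearOrder ι]
    (m : ι → MeasurableSpace Ω) (h : ∀ i, Indep (m i) (⨆ j, ⨆ _ : j < i, m j) μ) :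
    iIndep m μ := by
  rw [iIndep_iff]
  intro s
  induction s using Finset.induction_on_max with
  | empty => simp
  | insert a s has ih =>
    intro f hf
    have ha : a ∉ s := fun hmem => lt_irrefl _ (has a hmem)
    rw [Finset.prod_insert ha, Finset.set_biInter_insert,
      ← ih fun i hi => hf i (Finset.mem_insert_of_mem hi)]
    refine (Indep_iff _ _ _).1 (h a) _ _ (hf a (Finset.mem_insert_self _ _)) ?_
    refine MeasurableSet.biInter s.countable_toSet fun i hi => ?_
    exact le_iSup₂_of_le (f := fun j (_ : j < a) => m j) i (has i hi) le_rfl _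
      (hf i (Finset.mem_insert_of_mem hi))

/-- A finite-valued random variable generates the same σ-field as some real random variable. -/
theorem exists_measurableEmbedding_of_fintype (E : Type*) [Fintype E] [MeasurableSpace E]
    [MeasurableSingletonClass E] : ∃ c : E → ℝ, MeasurableEmbedding c := by
  refine ⟨fun y => ((Fintype.equivFin E y : ℕ) : ℝ), fun x y hxy => ?_, measurable_of_finite _,
    fun s _ => (s.toFinite.image _).measurableSet⟩
  exact (Fintype.equivFin E).injective (Fin.ext (Nat.cast_injective hxy))

theorem comap_measurableEmbedding_comp {E E' : Type*} [mE : MeasurableSpace E]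
    [mE' : MeasurableSpace E'] {c : E → E'} (hc : MeasurableEmbedding c) (X : Ω → E) :
    MeasurableSpace.comap (fun ω => c (X ω)) mE' = MeasurableSpace.comap X mE := by
  rw [← hc.comap_eq, MeasurableSpace.comap_comp]; rfl

end Independence

/-! ### Product-type filtrations from independent innovations -/

section ProductType

variable {Ω : Type*} {mΩ : MeasurableSpace Ω} {μ : Measure Ω}

/-- The values of `φ` that are at least `k` form a nonempty set of integers bounded below, hence
have a least element. So the blocks of times between consecutive values of `φ` leave no time
uncovered. -/
theorem iSup_preceding_blocks {κ : Type*} [LinearOrder κ] {φ : κ → ℤ} (hφ : StrictMono φ)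
    (d : κ) {k : ℤ} (hk : k ≤ φ d) : ∃ e ≤ d, k ≤ φ e ∧ ∀ e' < e, φ e' < k := by
  obtain ⟨z, ⟨⟨e, rfl⟩, hz⟩, hmin⟩ := Int.exists_least_of_bdd
    (P := fun z => z ∈ Set.range φ ∧ k ≤ z) ⟨k, fun z hz => hz.2⟩ ⟨φ d, ⟨d, rfl⟩, hk⟩
  refine ⟨e, hφ.le_iff_le.1 (hmin _ ⟨⟨d, rfl⟩, hk⟩), hz, fun e' he' => ?_⟩
  by_contra! hcon
  exact absurd (hmin _ ⟨⟨e', rfl⟩, hcon⟩) (not_le.2 (hφ he'))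

/-- A filtration extracted from a filtration generated, at the extracted times, by independent
innovations is of product type. -/
theorem isProductType_reindex [IsProbabilityMeasure μ] {κ : Type*} [LinearOrder κ]
    (ℱ : Filtration ℤ mΩ) {φ : κ → ℤ} (hφ : StrictMono φ) (U : ℤ → Ω → ℝ)
    (hU : ∀ k, Measurable (U k)) (hind : iIndepFun U μ)
    (hgen : ∀ d, ℱ (φ d) =
      completed μ (⨆ k : Set.Iic (φ d), MeasurableSpace.comap (U k) inferInstance)) :
    IsProductType μ (reindex ℱ φ hφ.monotone) := by
  -- A block gathers the innovations after all earlier extracted times; `V d` packs them into one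
  -- real variable by a measurable embedding.
  let block : κ → Set ℤ := fun d => {k | k ≤ φ d ∧ ∀ e < d, φ e < k}
  let V : κ → Ω → ℝ := fun d ω => embeddingReal (block d → ℝ) (fun k => U k ω)
  have hVm : ∀ d, Measurable (V d) := fun d =>
    (measurableEmbedding_embeddingReal _).measurable.comp (measurable_pi_lambda _ fun k => hU k)
  have hV : ∀ d, MeasurableSpace.comap (V d) inferInstance =
      ⨆ k ∈ block d, MeasurableSpace.comap (U k) inferInstance := by
    intro d
    rw [comap_measurableEmbedding_comp (measurableEmbedding_embeddingReal (block d → ℝ))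
      (fun ω (k : block d) => U k ω), MeasurableSpace.pi, MeasurableSpace.comap_iSup, iSup_subtype']
    refine iSup_congr fun k => ?_
    rw [MeasurableSpace.comap_comp]; rfl
  refine ⟨V, hVm, ?_, ?_⟩
  · refine iIndep_of_indep_iSup_lt _ fun d => ?_
    have hdisj : Disjoint (block d) {k | ∃ e < d, k ≤ φ e} := by
      rw [Set.disjoint_left]
      rintro k ⟨-, hk⟩ ⟨e, he, hke⟩
      exact absurd (hk e he) (not_lt.2 hke)
    have := indep_iSup_of_disjoint (fun k => (hU k).comap_le) hind hdisj
    rw [← hV d] at this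
    refine indep_of_indep_of_le_right this (iSup₂_le fun e he => ?_)
    rw [hV e]
    exact iSup₂_le fun k hk => le_iSup₂_of_le (f := fun k (_ : k ∈ {k | ∃ e < d, k ≤ φ e}) =>
      MeasurableSpace.comap (U k) inferInstance) k ⟨e, he, hk.1⟩ le_rfl
  · refine Filtration.ext (funext fun d => ?_)
    change ℱ (φ d) = completed μ _
    rw [hgen d]
    congr 1
    apply le_antisymm
    · refine iSup_le fun ⟨k, hk⟩ => ?_
      obtain ⟨e, hed, hke⟩ := iSup_preceding_blocks hφ d hk
      refine le_iSup_of_le (⟨e, hed⟩ : Set.Iic d) ?_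
      rw [hV e]
      exact le_iSup₂_of_le (f := fun k (_ : k ∈ block e) =>
        MeasurableSpace.comap (U k) inferInstance) k hke le_rfl
    · refine iSup_le fun ⟨e, he⟩ => ?_
      rw [hV e]
      exact iSup₂_le fun k hk => le_iSup_of_le
        (⟨k, hk.1.trans (hφ.monotone he)⟩ : Set.Iic (φ d)) le_rfl

theorem immersed_refl [IsFiniteMeasure μ] {ι : Type*} [Preorder ι] (ℱ : Filtration ι mΩ) :
    Immersed μ ℱ ℱ := by
  refine ⟨fun _ => le_rfl, fun m n hmn A B hA hB => ?_⟩
  have hA' : MeasurableSet A := ℱ.le n A hA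
  have hB' : MeasurableSet B := ℱ.le m B hB
  have hBs : StronglyMeasurable[ℱ m] (B.indicator fun _ => (1 : ℝ)) :=
    stronglyMeasurable_const.indicator hB
  have hmul : (A ∩ B).indicator (fun _ => (1 : ℝ)) =
      A.indicator (fun _ => (1 : ℝ)) * B.indicator (fun _ => (1 : ℝ)) := by
    ext ω
    by_cases h₁ : ω ∈ A <;> by_cases h₂ : ω ∈ B <;> simp [h₁, h₂]
  have hint : Integrable ((A ∩ B).indicator fun _ => (1 : ℝ)) μ :=
    (integrable_const _).indicator (hA'.inter hB')
  rw [condExp_of_stronglyMeasurable (ℱ.le m) hBs ((integrable_const _).indicator hB'), hmul]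
  exact condExp_mul_of_stronglyMeasurable_right hBs (hmul ▸ hint)
    ((integrable_const _).indicator hA')

/-- The identity isomorphism of a filtered probability space. -/
def FilteredIso.refl {ι : Type*} [Preorder ι] (μ : Measure Ω) (ℱ : Filtration ι mΩ) :
    FilteredIso μ ℱ μ ℱ where
  toEquiv := Equiv.refl _
  map_law _ := rfl
  map_borel _ _ _ _ h := h
  map_filtration _ _ := Iff.rfl

theorem IsProductType.isStandard [IsProbabilityMeasure μ] {ι : Type*} [Preorder ι]
    {ℱ : Filtration ι mΩ} (h : IsProductType μ ℱ) : IsStandard μ ℱ :=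
  ⟨Ω, mΩ, μ, ℱ, ℱ, inferInstance, h, ⟨FilteredIso.refl μ ℱ⟩, immersed_refl ℱ⟩

end ProductType

/-! ### Conditional laws of finite-valued variables -/

section FiniteValued

variable {Ω : Type*} {mΩ : MeasurableSpace Ω} {μ : Measure Ω}

theorem real_inter_preimage_eq_sum [IsFiniteMeasure μ] {E : Type*} [Fintype E] [MeasurableSpace E]
    [MeasurableSingletonClass E] {X : Ω → E} (hX : Measurable X) {B : Set Ω}
    (hB : MeasurableSet B) (T : Finset E) :
    μ.real (B ∩ X ⁻¹' T) = ∑ x ∈ T, μ.real (B ∩ X ⁻¹' {x}) := by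
  have h := sum_measureReal_preimage_singleton (μ := μ.restrict B) T (f := X)
    fun y _ => hX (measurableSet_singleton y)
  rw [measureReal_restrict_apply' hB, inter_comm] at h
  rw [← h]
  exact Finset.sum_congr rfl fun y _ => by rw [measureReal_restrict_apply' hB, inter_comm]

theorem real_eq_sum_inter_preimage [IsFiniteMeasure μ] {E : Type*} [Fintype E] [MeasurableSpace E]
    [MeasurableSingletonClass E] {X : Ω → E} (hX : Measurable X) {B : Set Ω}
    (hB : MeasurableSet B) : μ.real B = ∑ x, μ.real (B ∩ X ⁻¹' {x}) := by
  rw [← real_inter_preimage_eq_sum hX hB, Finset.coe_univ, preimage_univ, inter_univ]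

theorem measurable_comp₂_of_finite {E E' E'' : Type*} [Finite E] [Finite E'] [MeasurableSpace E]
    [MeasurableSingletonClass E] [MeasurableSpace E'] [MeasurableSingletonClass E']
    [MeasurableSpace E''] {m : MeasurableSpace Ω} {X : Ω → E} {Y : Ω → E'}
    (hX : Measurable[m] X) (hY : Measurable[m] Y) (f : E → E' → E'') :
    Measurable[m] fun ω => f (X ω) (Y ω) :=
  (measurable_of_finite (Function.uncurry f)).comp (hX.prodMk hY)

theorem condProb_eq {E E' : Type*} [MeasurableSpace E] [MeasurableSingletonClass E] {X : Ω → E}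
    (hX : Measurable X) (Y : Ω → E') (x : E) (y : E') :
    condProb μ Y X y x = (μ.real (X ⁻¹' {x}))⁻¹ * μ.real (X ⁻¹' {x} ∩ Y ⁻¹' {y}) := by
  rw [condProb, measureReal_def, cond_apply (hX (measurableSet_singleton x)), ENNReal.toReal_mul,
    ENNReal.toReal_inv]
  rfl

theorem condProb_eq_of_real_inter [IsProbabilityMeasure μ] {E E' : Type*} [Fintype E]
    [MeasurableSpace E] [MeasurableSingletonClass E] {X : Ω → E} {Y : Ω → E'}
    (hX : Measurable X) (hunif : IsUniform μ X) {x : E} {y : E'} {p : ℝ}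
    (h : μ.real (X ⁻¹' {x} ∩ Y ⁻¹' {y}) = μ.real (X ⁻¹' {x}) * p) : condProb μ Y X y x = p := by
  have hne : μ.real (X ⁻¹' {x}) ≠ 0 := by
    rw [hunif x]
    have : Nonempty E := ⟨x⟩
    positivity
  rw [condProb_eq hX, h, ← mul_assoc,
    inv_mul_cancel₀ hne, one_mul]

/-- The conditional law of a finite-valued random variable `Y` given a σ-field `m` is read off the
joint probabilities with the events of `m`. -/
theorem condExp_indicator_preimage_eq [IsProbabilityMeasure μ] {E E' : Type*} [Fintype E]
    [MeasurableSpace E] [MeasurableSingletonClass E] [Fintype E'] [MeasurableSpace E']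
    [MeasurableSingletonClass E'] {X : Ω → E} {Y : Ω → E'} (hY : Measurable Y)
    {m : MeasurableSpace Ω} (hm : m ≤ mΩ) (hX : Measurable[m] X) {p : E → E' → ℝ}
    (h : ∀ B, MeasurableSet[m] B → ∀ x y,
      μ.real (B ∩ X ⁻¹' {x} ∩ Y ⁻¹' {y}) = μ.real (B ∩ X ⁻¹' {x}) * p x y) (A : Finset E') :
    μ[(Y ⁻¹' A).indicator (fun _ => (1 : ℝ)) | m] =ᵐ[μ] fun ω => ∑ y ∈ A, p (X ω) y := by
  have hX' : Measurable[mΩ] X := hX.mono hm le_rfl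
  have hq : Measurable fun x => ∑ y ∈ A, p x y := measurable_of_finite _
  have hYA : MeasurableSet[mΩ] (Y ⁻¹' A) := hY A.measurableSet
  have hqint : Integrable (fun ω => ∑ y ∈ A, p (X ω) y) μ := by
    refine Integrable.of_bound (hq.comp hX').aestronglyMeasurable
      (∑ x, ‖∑ y ∈ A, p x y‖) (ae_of_all _ fun ω => ?_)
    exact Finset.single_le_sum (f := fun x => ‖∑ y ∈ A, p x y‖) (fun _ _ => norm_nonneg _)
      (Finset.mem_univ (X ω))
  refine (ae_eq_condExp_of_forall_setIntegral_eq hm ((integrable_const _).indicator hYA)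
    (fun s _ _ => hqint.integrableOn) (fun B hB _ => ?_)
    (hq.comp hX).stronglyMeasurable.aestronglyMeasurable).symm
  have hB' := hm B hB
  rw [setIntegral_indicator hYA, setIntegral_const, smul_eq_mul, mul_one]
  have hint : ∫ ω in B, (∑ y ∈ A, p (X ω) y) ∂μ =
      ∑ x, μ.real (B ∩ X ⁻¹' {x}) * ∑ y ∈ A, p x y := by
    have : ∀ ω, (∑ y ∈ A, p (X ω) y) =
        ∑ x, (X ⁻¹' {x}).indicator (fun _ => ∑ y ∈ A, p x y) ω := by
      classical
      intro ω
      rw [Finset.sum_eq_single (X ω)]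
      · simp
      · intro x _ hx
        exact indicator_of_notMem (fun hmem => hx (by simpa using hmem.symm)) _
      · simp
    simp_rw [this]
    rw [integral_finsetSum]
    · refine Finset.sum_congr rfl fun x _ => ?_
      rw [setIntegral_indicator (hX' (measurableSet_singleton x)), setIntegral_const, smul_eq_mul]
    · intro x _
      exact (integrable_const _).indicator (hX' (measurableSet_singleton x))
  rw [hint, real_inter_preimage_eq_sum hY hB']
  simp_rw [Finset.mul_sum]
  rw [Finset.sum_comm]
  refine Finset.sum_congr rfl fun y _ => ?_
  rw [real_eq_sum_inter_preimage hX' (hB'.inter (hY (measurableSet_singleton y)))]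
  refine Finset.sum_congr rfl fun x _ => ?_
  rw [← h B hB x y, inter_right_comm]

end FiniteValued

/-! ### Brick chains: Markov property and uniform innovations -/

/-- A process whose even-time values are independent and whose successive triples
`(Z (2n-2), Z (2n-1), Z (2n))` are strong bricks. -/
structure IsBrickChain {Ω : Type*} {mΩ : MeasurableSpace Ω} (μ : Measure Ω) {F : ℤ → Type*}
    [∀ n, Fintype (F n)] [∀ n, MeasurableSpace (F n)] (Z : ∀ n, Ω → F n) (r : ℤ → ℕ)
    (α : ℤ → ℝ) : Prop where
  meas : ∀ n ≤ 0, Measurable (Z n)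
  indep : iIndepFun (fun n : Set.Iic (0 : ℤ) => Z (2 * (n : ℤ))) μ
  brick : ∀ n ≤ 0, IsStrongBrick μ (Z (2 * n - 2)) (Z (2 * n - 1)) (Z (2 * n))
      (r (2 * n - 1)) (r (2 * n)) (α n)

section Chain

variable {Ω : Type*} {mΩ : MeasurableSpace Ω} {μ : Measure Ω} {F : ℤ → Type*}
  [∀ n, MeasurableSpace (F n)] {Z : ∀ n, Ω → F n} {r : ℤ → ℕ} {α : ℤ → ℝ}

theorem naturalFiltration_le {n : ℤ}
    {m : MeasurableSpace Ω}
    (hm : ∀ j ≤ n, MeasurableSpace.comap (Z j) inferInstance ≤ completed μ m) :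
    naturalFiltration μ Z n ≤ completed μ m :=
  completed_le_completed (iSup_le fun j => hm j.1 j.2)

variable [∀ n, Fintype (F n)]

theorem IsBrickChain.comap_le_naturalFiltration (h : IsBrickChain μ Z r α) {j n : ℤ}
    (hjn : j ≤ n) (hj : j ≤ 0) :
    MeasurableSpace.comap (Z j) inferInstance ≤ naturalFiltration μ Z n := by
  refine le_trans (le_completed (h.meas j hj).comap_le) (completed_mono μ ?_)
  exact le_iSup_of_le (⟨j, hjn⟩ : Set.Iic n) le_rfl

variable [∀ n, MeasurableSingletonClass (F n)]

/-- An odd value before time `2 * n` is a function of its even neighbours, both at times at most `2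
* n`. -/
theorem IsBrickChain.naturalFiltration_even_le (h : IsBrickChain μ Z r α) {n : ℤ} (hn : n ≤ 0) :
    naturalFiltration μ Z (2 * n) ≤ completed μ (⨆ i ∈ {i : Set.Iic (0 : ℤ) | (i : ℤ) ≤ n},
      MeasurableSpace.comap (Z (2 * (i : ℤ))) inferInstance) := by
  have heven : ∀ k ≤ n, MeasurableSpace.comap (Z (2 * k)) inferInstance ≤
      completed μ (⨆ i ∈ {i : Set.Iic (0 : ℤ) | (i : ℤ) ≤ n},
        MeasurableSpace.comap (Z (2 * (i : ℤ))) inferInstance) := by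
    intro k hk
    refine le_trans ?_ (le_completed (iSup₂_le fun i _ =>
      (h.meas _ (by have : (i : ℤ) ≤ 0 := i.2; omega)).comap_le))
    exact le_iSup₂_of_le (f := fun (i : Set.Iic (0 : ℤ)) (_ : i ∈ {i : Set.Iic (0 : ℤ) |
      (i : ℤ) ≤ n}) => MeasurableSpace.comap (Z (2 * (i : ℤ))) inferInstance)
      ⟨k, hk.trans hn⟩ hk le_rfl
  refine naturalFiltration_le fun j hj => ?_
  obtain ⟨k, rfl | rfl⟩ : ∃ k, j = 2 * k ∨ j = 2 * k - 1 := ⟨(j + 1) / 2, by omega⟩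
  · exact heven k (by omega)
  · obtain ⟨g, hg⟩ := (h.brick k (by omega)).eq_fun₁
    have h1 := heven (k - 1) (by omega)
    rw [show 2 * (k - 1) = 2 * k - 2 by ring] at h1
    refine comap_le_completed_of_ae_eq (h.meas _ (by omega)) ?_ hg
    exact measurable_comp₂_of_finite ((comap_measurable _).mono h1 le_rfl)
      ((comap_measurable _).mono (heven k (by omega)) le_rfl) g

theorem IsBrickChain.indep_naturalFiltration_even (h : IsBrickChain μ Z r α) {n : ℤ}
    (hn : n ≤ 0) :
    Indep (naturalFiltration μ Z (2 * n)) (⨆ i ∈ {i : Set.Iic (0 : ℤ) | n < i},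
      MeasurableSpace.comap (Z (2 * (i : ℤ))) inferInstance) μ := by
  refine indep_of_indep_of_le_left (Indep.completed_left ?_) (h.naturalFiltration_even_le hn)
  refine indep_iSup_of_disjoint (fun i => (h.meas _ ?_).comap_le) h.indep ?_
  · have : (i : ℤ) ≤ 0 := i.2
    omega
  · rw [Set.disjoint_left]
    intro i hi hi'
    exact absurd (show (i : ℤ) ≤ n from hi) (not_le.2 hi')

theorem IsBrickChain.indep_even (h : IsBrickChain μ Z r α) {n k : ℤ} (hk : k ≤ 0) (hnk : n < k) :
    Indep (naturalFiltration μ Z (2 * n)) (MeasurableSpace.comap (Z (2 * k)) inferInstance) μ :=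
  indep_of_indep_of_le_right (h.indep_naturalFiltration_even (hnk.le.trans hk))
    (le_iSup₂_of_le (f := fun (i : Set.Iic (0 : ℤ)) (_ : i ∈ {i : Set.Iic (0 : ℤ) |
      n < i}) => MeasurableSpace.comap (Z (2 * (i : ℤ))) inferInstance)
      ⟨k, hk⟩ hnk le_rfl)

/-- Once `Z (2n-2) = x` is fixed, `Z (2n-1)` is the function `g x` of `Z (2n)`, which is independent
of the past up to time `2n-2`. -/
theorem IsBrickChain.real_inter_odd [IsProbabilityMeasure μ] (h : IsBrickChain μ Z r α) {n : ℤ}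
    (hn : n ≤ 0)
    {B : Set Ω} (hB : MeasurableSet[naturalFiltration μ Z (2 * n - 2)] B) (x : F (2 * n - 2))
    (y : F (2 * n - 1)) :
    μ.real (B ∩ Z (2 * n - 2) ⁻¹' {x} ∩ Z (2 * n - 1) ⁻¹' {y}) =
      μ.real (B ∩ Z (2 * n - 2) ⁻¹' {x}) * condProb μ (Z (2 * n - 1)) (Z (2 * n - 2)) y x := by
  obtain ⟨g, hg⟩ := (h.brick n hn).eq_fun₁
  have key : ∀ B, MeasurableSet[naturalFiltration μ Z (2 * n - 2)] B →
      μ.real (B ∩ Z (2 * n - 2) ⁻¹' {x} ∩ Z (2 * n - 1) ⁻¹' {y}) =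
      μ.real (B ∩ Z (2 * n - 2) ⁻¹' {x}) * μ.real (Z (2 * n) ⁻¹' {z | g x z = y}) := by
    intro B hB
    have hBx : MeasurableSet[naturalFiltration μ Z (2 * n - 2)] (B ∩ Z (2 * n - 2) ⁻¹' {x}) :=
      hB.inter (h.comap_le_naturalFiltration le_rfl (by omega) _
        ⟨{x}, measurableSet_singleton x, rfl⟩)
    have hind := h.indep_even (n := n - 1) hn (by omega)
    rw [show 2 * (n - 1) = 2 * n - 2 by ring] at hind
    have hae : (B ∩ Z (2 * n - 2) ⁻¹' {x} ∩ Z (2 * n - 1) ⁻¹' {y} : Set Ω) =ᵐ[μ]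
        (B ∩ Z (2 * n - 2) ⁻¹' {x} ∩ Z (2 * n) ⁻¹' {z | g x z = y} : Set Ω) := by
      filter_upwards [hg] with ω hω
      refine propext (and_congr_right fun hx => ?_)
      change Z (2 * n - 1) ω = y ↔ g x (Z (2 * n) ω) = y
      rw [hω, show Z (2 * n - 2) ω = x from hx.2]
    rw [measureReal_congr hae, measureReal_def, (Indep_iff _ _ _).1 hind _ _ hBx
      ⟨_, Set.Finite.measurableSet (Set.toFinite _), rfl⟩, ENNReal.toReal_mul]
    rfl
  rw [key B hB, condProb_eq_of_real_inter (h.meas _ (by omega)) (h.brick n hn).uniform₀]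
  have := key univ MeasurableSet.univ
  rwa [univ_inter] at this

/-- On the event `Z (2n-1) = y`, the past of `Z` up to time `2n-1` reduces to its past up to time
`2n-4`. -/
theorem IsBrickChain.naturalFiltration_odd_le (h : IsBrickChain μ Z r α) {n : ℤ} (hn : n ≤ 0)
    (y : F (2 * n - 1)) :
    naturalFiltration μ Z (2 * n - 1) ≤ eventuallyMeasurableSpace
      (naturalFiltration μ Z (2 * (n - 2))) (ae (μ.restrict (Z (2 * n - 1) ⁻¹' {y}))) := by
  set C := Z (2 * n - 1) ⁻¹' {y}
  have hC : MeasurableSet C := h.meas _ (by omega) (measurableSet_singleton y)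
  have hy : ∀ᵐ ω ∂μ.restrict C, Z (2 * n - 1) ω = y := by
    filter_upwards [ae_restrict_mem hC] with ω hω using hω
  -- The time is a variable with an equation because it is needed both as `2 * n - 2` and as `2 * (n
  -- - 1)`, and the type of `Z j` depends on it.
  have hconst : ∀ j, j = 2 * n - 2 → ∃ c : F j, ∀ᵐ ω ∂μ.restrict C, Z j ω = c := by
    rintro j rfl
    obtain ⟨f, hf⟩ := (h.brick n hn).eq_fun₀
    refine ⟨f y, ?_⟩
    filter_upwards [hy, ae_restrict_of_ae hf] with ω hω hω'
    rw [hω', hω]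
  have hcomap : ∀ j ≤ 2 * n - 1, MeasurableSpace.comap (Z j) inferInstance ≤
      eventuallyMeasurableSpace (naturalFiltration μ Z (2 * (n - 2))) (ae (μ.restrict C)) := by
    intro j hj
    obtain hj' | rfl | rfl | rfl :
        j ≤ 2 * n - 4 ∨ j = 2 * (n - 1) - 1 ∨ j = 2 * n - 2 ∨ j = 2 * n - 1 := by omega
    · exact (h.comap_le_naturalFiltration (by omega) (by omega)).trans
        le_eventuallyMeasurableSpace
    · obtain ⟨g, hg⟩ := (h.brick (n - 1) (by omega)).eq_fun₁
      obtain ⟨c, hc⟩ := hconst (2 * (n - 1)) (by ring)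
      have hmeas : Measurable[naturalFiltration μ Z (2 * (n - 2))]
          fun ω => g (Z (2 * (n - 1) - 2) ω) c :=
        (measurable_of_finite fun x => g x c).comp
          ((comap_measurable _).mono (h.comap_le_naturalFiltration (by omega) (by omega)) le_rfl)
      refine Measurable.comap_le (hmeas.eventuallyMeasurable_of_eventuallyEq ?_)
      filter_upwards [hc, ae_restrict_of_ae hg] with ω hω hω'
      rw [hω', hω]
    · obtain ⟨c, hc⟩ := hconst _ rfl
      exact Measurable.comap_le (measurable_const.eventuallyMeasurable_of_eventuallyEq hc)
    · exact Measurable.comap_le (measurable_const.eventuallyMeasurable_of_eventuallyEq hy)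
  intro s hs
  obtain ⟨⟨t, ht, hst⟩, -⟩ := measurableSet_completed_iff.1 hs
  obtain ⟨u, hu, htu⟩ := iSup_le (fun j : Set.Iic (2 * n - 1) => hcomap j.1 j.2) t ht
  exact ⟨u, hu, EventuallyEq.trans (hst.filter_mono (ae_mono Measure.restrict_le_self)) htu⟩

/-- On `Z (2n-1) = x`, the event `B` coincides with an event `B'` known at time `2n-4`, while the
rest is an event of `(Z (2n-2), Z (2n))`, independent of `B'`. The factor `μ.real B'` then cancels
between the cases of a full and of a one-point target set. -/
theorem IsBrickChain.real_inter_even [IsProbabilityMeasure μ] (h : IsBrickChain μ Z r α) {n : ℤ}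
    (hn : n ≤ 0)
    {B : Set Ω} (hB : MeasurableSet[naturalFiltration μ Z (2 * n - 1)] B) (x : F (2 * n - 1))
    (y : F (2 * n)) :
    μ.real (B ∩ Z (2 * n - 1) ⁻¹' {x} ∩ Z (2 * n) ⁻¹' {y}) =
      μ.real (B ∩ Z (2 * n - 1) ⁻¹' {x}) * condProb μ (Z (2 * n)) (Z (2 * n - 1)) y x := by
  obtain ⟨g, hg⟩ := (h.brick n hn).eq_fun₁
  set C := Z (2 * n - 1) ⁻¹' {x} with hCdef
  have hC : MeasurableSet C := h.meas _ (by omega) (measurableSet_singleton x)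
  obtain ⟨B', hB', hBB'⟩ := h.naturalFiltration_odd_le hn x B hB
  have hind := h.indep_naturalFiltration_even (n := n - 2) (by omega)
  have hmeas : ∀ k, n - 2 < k → k ≤ 0 → Measurable[⨆ i ∈ {i : Set.Iic (0 : ℤ) | n - 2 < i},
      MeasurableSpace.comap (Z (2 * (i : ℤ))) inferInstance] (Z (2 * k)) := fun k hk hk0 =>
    (comap_measurable _).mono (le_iSup₂_of_le (f := fun (i : Set.Iic (0 : ℤ))
      (_ : i ∈ {i : Set.Iic (0 : ℤ) | n - 2 < i}) =>
        MeasurableSpace.comap (Z (2 * (i : ℤ))) inferInstance) ⟨k, hk0⟩ hk le_rfl) le_rfl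
  have hmeas' := hmeas (n - 1) (by omega) (by omega)
  rw [show 2 * (n - 1) = 2 * n - 2 by ring] at hmeas'
  have hprod : ∀ T : Set (F (2 * n)), μ.real (B ∩ C ∩ Z (2 * n) ⁻¹' T) =
      μ.real B' * μ.real (C ∩ Z (2 * n) ⁻¹' T) := by
    intro T
    have hae : (C ∩ Z (2 * n) ⁻¹' T : Set Ω) =ᵐ[μ]
        ((fun ω => (Z (2 * n - 2) ω, Z (2 * n) ω)) ⁻¹' {q | g q.1 q.2 = x ∧ q.2 ∈ T} : Set Ω) := by
      filter_upwards [hg] with ω hω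
      refine propext (and_congr_left fun _ => ?_)
      change Z (2 * n - 1) ω = x ↔ g (Z (2 * n - 2) ω) (Z (2 * n) ω) = x
      rw [hω]
    have hT : MeasurableSet (C ∩ Z (2 * n) ⁻¹' T) :=
      hC.inter (h.meas _ (by omega) T.toFinite.measurableSet)
    have h1 : μ.real (B ∩ C ∩ Z (2 * n) ⁻¹' T) = μ.real (B' ∩ (C ∩ Z (2 * n) ⁻¹' T)) := by
      have := measureReal_congr (hBB'.inter (ae_eq_refl (Z (2 * n) ⁻¹' T)))
      rw [measureReal_restrict_apply' hC, measureReal_restrict_apply' hC] at this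
      rw [inter_right_comm, this, inter_right_comm, inter_assoc]
    rw [h1, measureReal_congr ((ae_eq_refl B').inter hae), measureReal_congr hae, measureReal_def,
      (Indep_iff _ _ _).1 hind _ _ hB' ((hmeas'.prodMk (hmeas n (by omega) hn))
        (Set.toFinite _).measurableSet), ENNReal.toReal_mul]
    rfl
  have h1 := hprod univ
  have h2 := hprod {y}
  rw [preimage_univ, inter_univ, inter_univ] at h1
  rw [h1, h2, condProb_eq (h.meas _ (by omega)), mul_assoc]
  congr 1
  have hne : μ.real C ≠ 0 := by
    rw [hCdef, (h.brick n hn).uniform₁ x]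
    have : Nonempty (F (2 * n - 1)) := ⟨x⟩
    positivity
  rw [← mul_assoc, mul_inv_cancel₀ hne, one_mul]

/-- Given the past up to time `m`, the next value `Z n` is uniform on a set of size `r n` that
depends only on `Z m`. -/
theorem IsBrickChain.exists_transition [IsProbabilityMeasure μ] (h : IsBrickChain μ Z r α)
    {m n : ℤ} (hmn : m + 1 = n) (hn : n ≤ 0) :
    0 < r n ∧ ∃ S : F m → Finset (F n), (∀ x, (S x).card = r n) ∧
      ∀ B, MeasurableSet[naturalFiltration μ Z m] B → ∀ x y,
        μ.real (B ∩ Z m ⁻¹' {x} ∩ Z n ⁻¹' {y}) =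
          μ.real (B ∩ Z m ⁻¹' {x}) * (S x : Set (F n)).indicator (fun _ => 1 / (r n : ℝ)) y := by
  have key : ∀ {p : F n → F m → ℝ} {S : F m → Finset (F n)},
      (∀ x, (S x).card = r n ∧ (∀ y ∈ S x, p y x = 1 / (r n : ℝ)) ∧ ∀ y ∉ S x, p y x = 0) →
      ∀ x y, p y x = (S x : Set (F n)).indicator (fun _ => 1 / (r n : ℝ)) y := by
    intro p S hS x y
    by_cases hy : y ∈ S x
    · rw [(hS x).2.1 y hy, indicator_of_mem (Finset.mem_coe.2 hy)]
    · rw [(hS x).2.2 y hy, indicator_of_notMem (fun h => hy (Finset.mem_coe.1 h))]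
  obtain ⟨k, hk⟩ : ∃ k, n = 2 * k ∨ n = 2 * k - 1 := ⟨(n + 1) / 2, by omega⟩
  rcases hk with rfl | rfl
  · obtain rfl : m = 2 * k - 1 := by omega
    obtain ⟨S, hS⟩ := (h.brick k (by omega)).cond₂
    refine ⟨(h.brick k (by omega)).pos₂, S, fun x => (hS x).1, fun B hB x y => ?_⟩
    rw [h.real_inter_even (by omega) hB, key hS]
  · obtain rfl : m = 2 * k - 2 := by omega
    obtain ⟨S, hS⟩ := (h.brick k (by omega)).cond₁
    refine ⟨(h.brick k (by omega)).pos₁, S, fun x => (hS x).1, fun B hB x y => ?_⟩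
    rw [h.real_inter_odd (by omega) hB, key hS]

theorem IsBrickChain.isMarkov [IsProbabilityMeasure μ] (h : IsBrickChain μ Z r α) :
    IsMarkov μ Z := by
  intro n hn A _
  obtain ⟨-, S, -, hS⟩ := h.exists_transition (sub_add_cancel n 1) hn
  have hle := h.comap_le_naturalFiltration (le_refl (n - 1)) (by omega)
  rw [← A.toFinite.coe_toFinset]
  exact (condExp_indicator_preimage_eq (h.meas n hn) ((naturalFiltration μ Z).le _)
    ((comap_measurable _).mono hle le_rfl) hS _).trans
    (condExp_indicator_preimage_eq (h.meas n hn) (h.meas _ (by omega)).comap_le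
      (comap_measurable _) (fun B hB => hS B (hle B hB)) _).symm

/-- Existence of uniform innovations. -/
theorem IsBrickChain.exists_innovation [IsProbabilityMeasure μ] (h : IsBrickChain μ Z r α)
    {m n : ℤ} (hmn : m + 1 = n) (hn : n ≤ 0) :
    ∃ U : Ω → Fin (r n), Measurable U ∧ (∀ i, μ.real (U ⁻¹' {i}) = 1 / (r n : ℝ)) ∧
      Indep (naturalFiltration μ Z m) (MeasurableSpace.comap U inferInstance) μ ∧
      MeasurableSpace.comap U inferInstance ≤ naturalFiltration μ Z n ∧
      MeasurableSpace.comap (Z n) inferInstance ≤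
        completed μ (MeasurableSpace.comap (Z m) inferInstance ⊔
          MeasurableSpace.comap U inferInstance) := by
  classical
  obtain ⟨hr, S, hcard, hS⟩ := h.exists_transition hmn hn
  have hm : m ≤ 0 := by omega
  let e : ∀ x, S x ≃ Fin (r n) := fun x => (S x).equivFinOfCardEq (hcard x)
  -- The innovation is the label of `Z n` in its conditional support. The default label is used only
  -- on a null event; it exists because `r n` is positive.
  let u : F m → F n → Fin (r n) := fun x y => if hy : y ∈ S x then e x ⟨y, hy⟩ else ⟨0, hr⟩
  let v : F m → Fin (r n) → F n := fun x i => ((e x).symm i : F n)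
  have huv : ∀ x y i, y ∈ S x → (u x y = i ↔ y = v x i) := by
    intro x y i hy
    simp only [u, v, dif_pos hy]
    rw [← Equiv.eq_symm_apply, Subtype.ext_iff]
  have hvS : ∀ x i, v x i ∈ S x := fun x i => ((e x).symm i).2
  let U : Ω → Fin (r n) := fun ω => u (Z m ω) (Z n ω)
  have hZm := h.meas m hm
  have hZn := h.meas n hn
  have hUcomp : Measurable[naturalFiltration μ Z n] U :=
    measurable_comp₂_of_finite
      ((comap_measurable _).mono (h.comap_le_naturalFiltration (by omega) hm) le_rfl)
      ((comap_measurable _).mono (h.comap_le_naturalFiltration le_rfl hn) le_rfl) u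
  have hU : Measurable U := hUcomp.mono ((naturalFiltration μ Z).le n) le_rfl
  have hsupp : ∀ᵐ ω ∂μ, Z n ω ∈ S (Z m ω) := by
    have : ∀ x y, y ∉ S x → ∀ᵐ ω ∂μ, ¬ (Z m ω = x ∧ Z n ω = y) := by
      intro x y hy
      have h0 := hS univ MeasurableSet.univ x y
      rw [indicator_of_notMem (fun h => hy (Finset.mem_coe.1 h)), mul_zero, univ_inter,
        measureReal_eq_zero_iff] at h0
      rw [ae_iff]
      simp only [not_not]
      exact h0
    have h2 : ∀ᵐ ω ∂μ, ∀ x y, y ∉ S x → ¬ (Z m ω = x ∧ Z n ω = y) :=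
      ae_all_iff.2 fun x => ae_all_iff.2 fun y => eventually_imp_distrib_left.2 (this x y)
    filter_upwards [h2] with ω hω
    by_contra hcon
    exact hω _ _ hcon ⟨rfl, rfl⟩
  -- For fixed `x`, the label `i` singles out the point `v x i`, whose conditional mass `1 / r n`
  -- does not depend on `x`.
  have hreal : ∀ B, MeasurableSet[naturalFiltration μ Z m] B → ∀ i,
      μ.real (B ∩ U ⁻¹' {i}) = μ.real B * (1 / (r n : ℝ)) := by
    intro B hB i
    have hB' : MeasurableSet B := (naturalFiltration μ Z).le m B hB
    rw [real_eq_sum_inter_preimage hZm (hB'.inter (hU (measurableSet_singleton i))),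
      real_eq_sum_inter_preimage hZm hB', Finset.sum_mul]
    refine Finset.sum_congr rfl fun x _ => ?_
    have hae : (B ∩ U ⁻¹' {i} ∩ Z m ⁻¹' {x} : Set Ω) =ᵐ[μ]
        (B ∩ Z m ⁻¹' {x} ∩ Z n ⁻¹' {v x i} : Set Ω) := by
      rw [inter_right_comm]
      filter_upwards [hsupp] with ω hω
      refine propext (and_congr_right fun hx => ?_)
      have hx' : Z m ω = x := hx.2
      rw [hx'] at hω
      change u (Z m ω) (Z n ω) = i ↔ Z n ω = v x i
      rw [hx']
      exact huv x _ i hω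
    rw [measureReal_congr hae, hS B hB, indicator_of_mem (Finset.mem_coe.2 (hvS x i))]
  refine ⟨U, hU, fun i => ?_, ?_, hUcomp.comap_le, ?_⟩
  · have := hreal univ MeasurableSet.univ i
    rwa [univ_inter, probReal_univ, one_mul] at this
  · rw [Indep_iff]
    rintro B _ hB ⟨T, -, rfl⟩
    have hB' : MeasurableSet B := (naturalFiltration μ Z).le m B hB
    rw [← T.toFinite.coe_toFinset, ← ENNReal.toReal_eq_toReal_iff' (by finiteness) (by finiteness),
      ENNReal.toReal_mul]
    change μ.real _ = μ.real _ * μ.real _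
    have h1 := real_inter_preimage_eq_sum (μ := μ) hU MeasurableSet.univ T.toFinite.toFinset
    rw [univ_inter] at h1
    rw [real_inter_preimage_eq_sum hU hB', h1, Finset.mul_sum]
    refine Finset.sum_congr rfl fun i _ => ?_
    rw [hreal B hB, hreal univ MeasurableSet.univ, probReal_univ, one_mul]
  · have hv : Measurable[completed μ (MeasurableSpace.comap (Z m) inferInstance ⊔
          MeasurableSpace.comap U inferInstance)] fun ω => v (Z m ω) (U ω) := by
      have hle := le_completed (μ := μ) (sup_le hZm.comap_le hU.comap_le)
      have h1 := le_sup_left.trans hle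
      have h2 := le_sup_right.trans hle
      exact measurable_comp₂_of_finite ((comap_measurable _).mono h1 le_rfl)
        ((comap_measurable _).mono h2 le_rfl) v
    refine comap_le_completed_of_ae_eq hZn hv ?_
    filter_upwards [hsupp] with ω hω
    exact (huv _ _ _ hω).1 rfl

theorem IsBrickChain.isAdicFiltration [IsProbabilityMeasure μ] (h : IsBrickChain μ Z r α) :
    IsAdicFiltration μ (naturalFiltration μ Z) r := by
  intro n hn
  obtain ⟨U, hU, hunif, hind, hle, hgen⟩ := h.exists_innovation (sub_add_cancel n 1) hn
  refine ⟨U, hU, hunif, hind, le_antisymm (naturalFiltration_le fun j hj => ?_)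
    (completed_le_completed (sup_le ((naturalFiltration μ Z).mono (by omega)) hle))⟩
  rcases hj.lt_or_eq with hj | rfl
  · exact (h.comap_le_naturalFiltration (by omega) (by omega)).trans
      (le_sup_left.trans (le_completed (sup_le ((naturalFiltration μ Z).le _) hU.comap_le)))
  · exact hgen.trans (completed_mono μ
      (sup_le_sup_right (h.comap_le_naturalFiltration le_rfl (by omega)) _))

end Chain

/-! ### Standardness when infinitely many odd times are skipped -/

section Standard

variable {Ω : Type*} {mΩ : MeasurableSpace Ω} {μ : Measure Ω} {F : ℤ → Type*}
  [∀ n, Fintype (F n)] [∀ n, MeasurableSpace (F n)] [∀ n, MeasurableSingletonClass (F n)]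
  {Z : ∀ n, Ω → F n} {r : ℤ → ℕ} {α : ℤ → ℝ}

theorem exists_real_comap_eq {E : Type*} [Fintype E] [MeasurableSpace E]
    [MeasurableSingletonClass E] {X : Ω → E} (hX : Measurable X) :
    ∃ U : Ω → ℝ, Measurable U ∧
      MeasurableSpace.comap U inferInstance = MeasurableSpace.comap X inferInstance := by
  obtain ⟨c, hc⟩ := exists_measurableEmbedding_of_fintype E
  exact ⟨fun ω => c (X ω), hc.measurable.comp hX, comap_measurableEmbedding_comp hc X⟩

theorem exists_real_comap_eq_bot :
    ∃ U : Ω → ℝ, Measurable U ∧ MeasurableSpace.comap U inferInstance = ⊥ :=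
  ⟨fun _ => 0, measurable_const, MeasurableSpace.comap_const 0⟩

/-- If the times `2n-1`, `n ∈ M`, are skipped, then at the other times the filtration of a brick
chain is generated by independent innovations as soon as `M` is infinite. -/
theorem IsBrickChain.exists_independent_innovations [IsProbabilityMeasure μ]
    (h : IsBrickChain μ Z r α) {M : Set ℤ} (hM0 : ∀ n ∈ M, n ≤ 0) (hM : M.Infinite) :
    ∃ U : ℤ → Ω → ℝ, (∀ k, Measurable (U k)) ∧ iIndepFun U μ ∧
      ∀ d ≤ 0, (∀ n ∈ M, d ≠ 2 * n - 1) → naturalFiltration μ Z d =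
        completed μ (⨆ k : Set.Iic d, MeasurableSpace.comap (U k) inferInstance) := by
  -- The innovation is trivial at skipped times `2n-1` and at positive times, equal to `Z (2n)`
  -- right after a skipped time, and uniform from the brick transitions elsewhere.
  have hex : ∀ k : ℤ, ∃ U : Ω → ℝ, Measurable U ∧
      MeasurableSpace.comap U inferInstance ≤ naturalFiltration μ Z k ∧
      ((0 < k ∨ ∃ n ∈ M, k = 2 * n - 1) → MeasurableSpace.comap U inferInstance = ⊥) ∧
      ((∃ n ∈ M, k = 2 * n) → MeasurableSpace.comap U inferInstance =
        MeasurableSpace.comap (Z k) inferInstance) ∧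
      (k ≤ 0 → (∀ n ∈ M, k ≠ 2 * n - 1 ∧ k ≠ 2 * n) →
        Indep (MeasurableSpace.comap U inferInstance) (naturalFiltration μ Z (k - 1)) μ ∧
        MeasurableSpace.comap (Z k) inferInstance ≤ completed μ
          (MeasurableSpace.comap (Z (k - 1)) inferInstance ⊔
            MeasurableSpace.comap U inferInstance)) := by
    intro k
    by_cases h1 : 0 < k ∨ ∃ n ∈ M, k = 2 * n - 1
    · obtain ⟨U, hU, hbot⟩ := exists_real_comap_eq_bot (Ω := Ω)
      refine ⟨U, hU, hbot ▸ bot_le, fun _ => hbot, ?_, fun hk hk' => ?_⟩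
      · rintro ⟨n, hn, rfl⟩
        have := hM0 n hn
        rcases h1 with h1 | ⟨n', -, h1⟩ <;> omega
      · rcases h1 with h1 | ⟨n', hn', h1⟩
        · omega
        · exact absurd h1 (hk' n' hn').1
    by_cases h2 : ∃ n ∈ M, k = 2 * n
    · obtain ⟨U, hU, hcomap⟩ := exists_real_comap_eq (h.meas k (by omega))
      refine ⟨U, hU, hcomap ▸ h.comap_le_naturalFiltration le_rfl (by omega),
        fun h => absurd h h1, fun _ => hcomap, fun _ hk => ?_⟩
      obtain ⟨n, hn, hk'⟩ := h2
      exact absurd hk' (hk n hn).2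
    have hk : k ≤ 0 := by
      by_contra hk
      exact h1 (Or.inl (by omega))
    obtain ⟨U', hU', -, hind, hle, hgen⟩ := h.exists_innovation (sub_add_cancel k 1) hk
    obtain ⟨U, hU, hcomap⟩ := exists_real_comap_eq hU'
    refine ⟨U, hU, ?_, fun h => absurd h h1, fun h => absurd h h2, fun _ _ => ?_⟩
    · rw [hcomap]; exact hle
    · rw [hcomap]; exact ⟨hind.symm, hgen⟩
  choose U hU hle hbot heven hinnov using hex
  have hlt : ∀ k n : ℤ, (∀ j < k, j ≤ n ∨ ∃ i ∈ M, j = 2 * i - 1) →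
      (⨆ j, ⨆ _ : j < k, MeasurableSpace.comap (U j) inferInstance) ≤
        naturalFiltration μ Z n := by
    refine fun k n hkn => iSup₂_le fun j hj => ?_
    rcases hkn j hj with hj | hj
    · exact (hle j).trans ((naturalFiltration μ Z).mono hj)
    · rw [hbot j (Or.inr hj)]; exact bot_le
  refine ⟨U, hU, iIndep_of_indep_iSup_lt _ fun k => ?_, fun d hd hdM => ?_⟩
  · by_cases h1 : 0 < k ∨ ∃ n ∈ M, k = 2 * n - 1
    · rw [hbot k h1]
      exact indep_bot_left _
    by_cases h2 : ∃ n ∈ M, k = 2 * n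
    · rw [heven k h2]
      obtain ⟨n, hn, rfl⟩ := h2
      -- The innovation at time `2n-1` being trivial, those before `2n` live in the past up to `2 *
      -- (n - 1)`, of which `Z (2n)` is independent.
      refine indep_of_indep_of_le_right (h.indep_even (hM0 n hn) (sub_one_lt n)).symm
        (hlt _ _ fun j hj => ?_)
      by_cases hj' : j = 2 * n - 1
      · exact Or.inr ⟨n, hn, hj'⟩
      · left; omega
    · push Not at h1 h2
      refine indep_of_indep_of_le_right (hinnov k h1.1 fun n hn => ⟨h1.2 n hn, h2 n hn⟩).1
        (hlt _ _ fun j hj => Or.inl (by omega))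
  · set 𝒰 : ℤ → MeasurableSpace Ω := fun d =>
      ⨆ k : Set.Iic d, MeasurableSpace.comap (U k) inferInstance
    have h𝒰 : ∀ d, 𝒰 d ≤ mΩ := fun d => iSup_le fun k => (hU k).comap_le
    have h𝒰mono : Monotone 𝒰 := fun d e hde => iSup_le fun k =>
      le_iSup_of_le (⟨k.1, k.2.trans hde⟩ : Set.Iic e) le_rfl
    have hU𝒰 : ∀ d, MeasurableSpace.comap (U d) inferInstance ≤ 𝒰 d := fun d =>
      le_iSup_of_le (⟨d, Set.mem_Iic.2 le_rfl⟩ : Set.Iic d) le_rfl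
    have hskip : ∀ n ∈ M, MeasurableSpace.comap (Z (2 * n)) inferInstance ≤
        completed μ (𝒰 (2 * n)) := fun n hn =>
      (heven _ ⟨n, hn, rfl⟩).symm.le.trans ((hU𝒰 _).trans (le_completed (h𝒰 _)))
    -- Forward induction from a restart time `2n`. A step from a skipped time `2i-1` would end at
    -- the restart time `2i`, so it never needs the skipped value.
    have hrec : ∀ n ∈ M, ∀ e, 2 * n ≤ e → e ≤ 0 → (∀ i ∈ M, e ≠ 2 * i - 1) →
        MeasurableSpace.comap (Z e) inferInstance ≤ completed μ (𝒰 e) := by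
      intro n hn e hne
      induction e, hne using Int.leInduction with
      | base => exact fun _ _ => hskip n hn
      | succ e hne ih =>
        intro he heM
        by_cases h2 : ∃ i ∈ M, e + 1 = 2 * i
        · obtain ⟨i, hi, hei⟩ := h2
          rw [hei]
          exact hskip i hi
        push Not at h2
        have hprev := ih (by omega) fun i hi hei => h2 i hi (by omega)
        have hgen := (hinnov (e + 1) he fun i hi => ⟨heM i hi, h2 i hi⟩).2
        rw [add_sub_cancel_right] at hgen
        exact hgen.trans (completed_le_completed (sup_le
          (hprev.trans (completed_mono μ (h𝒰mono (by omega))))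
          ((hU𝒰 _).trans (le_completed (h𝒰 _)))))
    have hfar : ∀ e : ℤ, ∃ n ∈ M, 2 * n ≤ e := by
      intro e
      by_contra! hcon
      refine hM ((Set.finite_Icc (e / 2) 0).subset fun n hn => ⟨?_, hM0 n hn⟩)
      have := hcon n hn
      omega
    have hZ𝒰 : ∀ e ≤ 0, (∀ i ∈ M, e ≠ 2 * i - 1) →
        MeasurableSpace.comap (Z e) inferInstance ≤ completed μ (𝒰 e) := by
      intro e he heM
      obtain ⟨n, hn, hne⟩ := hfar e
      exact hrec n hn e hne he heM
    refine le_antisymm (naturalFiltration_le fun e he => ?_) (completed_le_completed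
      (iSup_le fun k => (hle k).trans ((naturalFiltration μ Z).mono k.2)))
    by_cases heM : ∃ i ∈ M, e = 2 * i - 1
    · obtain ⟨i, hi, rfl⟩ := heM
      -- As `d` is not itself a skipped time, `2i` is still at most `d`, so both even neighbours of
      -- the skipped value are available.
      have hid : 2 * i ≤ d := by
        have := hdM i hi
        omega
      have hi0 := hM0 i hi
      obtain ⟨g, hg⟩ := (h.brick i hi0).eq_fun₁
      have h1 := (hZ𝒰 (2 * i - 2) (by omega) fun n hn => by omega).trans
        (completed_mono μ (h𝒰mono (show 2 * i - 2 ≤ d by omega)))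
      have h2 := (hZ𝒰 (2 * i) (by omega) fun n hn => by omega).trans
        (completed_mono μ (h𝒰mono hid))
      exact comap_le_completed_of_ae_eq (h.meas _ (by omega)) (measurable_comp₂_of_finite
        ((comap_measurable _).mono h1 le_rfl) ((comap_measurable _).mono h2 le_rfl) g) hg
    · push Not at heM
      exact (hZ𝒰 e (he.trans hd) heM).trans (completed_mono μ (h𝒰mono he))

theorem IsBrickChain.isStandard_reindex [IsProbabilityMeasure μ] (h : IsBrickChain μ Z r α)
    {κ : Type*} [LinearOrder κ] {φ : κ → ℤ} (hφ : StrictMono φ) (hφ0 : ∀ d, φ d ≤ 0)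
    (hinf : {n : ℤ | n ≤ 0 ∧ 2 * n - 1 ∉ Set.range φ}.Infinite) :
    IsStandard μ (reindex (naturalFiltration μ Z) φ hφ.monotone) := by
  obtain ⟨U, hU, hind, hgen⟩ := h.exists_independent_innovations (fun n hn => hn.1) hinf
  exact (isProductType_reindex _ hφ U hU hind fun d => hgen _ (hφ0 d)
    fun n hn hd => hn.2 ⟨d, hd⟩).isStandard

end Standard

/-! ### Backward chains, the obstruction to standardness -/

/-- `X k` is a finite-valued random variable known at time `j k`, and `p k` is the conditional law
of `f k (X k)` given the past up to time `j (k + 1)`, which depends only on `X (k + 1)`. -/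
structure IsBackwardChain {Ω κ : Type*} [Preorder κ] {mΩ : MeasurableSpace Ω} (μ : Measure Ω)
    (ℱ : Filtration κ mΩ) (j : ℕ → κ) {G E : ℕ → Type*} [∀ k, MeasurableSpace (G k)]
    (f : ∀ k, G k → E k) (p : ∀ k, G (k + 1) → E k → ℝ) (X : ∀ k, Ω → G k) : Prop where
  meas : ∀ k, Measurable[ℱ (j k)] (X k)
  trans : ∀ k B, MeasurableSet[ℱ (j (k + 1))] B → ∀ x z,
    μ.real (B ∩ X (k + 1) ⁻¹' {x} ∩ {ω | f k (X k ω) = z}) =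
      μ.real (B ∩ X (k + 1) ⁻¹' {x}) * p k x z
  bound : ∀ k x, μ.real (X k ⁻¹' {x}) ≤ 1 / 2

theorem stronglyMeasurable_comp_seq {Ω : Type*} {m : MeasurableSpace Ω} {x : ℕ → Ω → ℝ}
    (hx : ∀ k, StronglyMeasurable (x k)) {g : (ℕ → ℝ) → ℝ} (hg : Measurable g) :
    StronglyMeasurable fun ω => g fun k => x k ω :=
  (hg.comp (measurable_pi_lambda _ fun k => (hx k).measurable)).stronglyMeasurable

theorem exists_mem_L0_comp {Ω : Type*} (m : MeasurableSpace Ω) {mΩ : MeasurableSpace Ω}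
    {μ : Measure Ω} (hm : m ≤ mΩ) (X : ℕ → L0 μ m)
    {g : (ℕ → ℝ) → ℝ} (hg : Measurable g) :
    ∃ Y : L0 μ m, (Y : Ω →ₘ[μ] ℝ) =ᵐ[μ] fun ω => g fun k => (X k : Ω →ₘ[μ] ℝ) ω := by
  choose x hx hXx using fun k => (X k).2
  have hmeas : StronglyMeasurable[m] fun ω => g fun k => x k ω :=
    stronglyMeasurable_comp_seq hx hg
  refine ⟨⟨AEEqFun.mk _ (hmeas.mono hm).aestronglyMeasurable, _, hmeas, AEEqFun.coeFn_mk _ _⟩, ?_⟩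
  refine (AEEqFun.coeFn_mk _ _).trans ?_
  filter_upwards [ae_all_iff.2 hXx] with ω hω
  simp only [hω]

/-! ### Transport of backward chains by isomorphisms -/

section Isomorphism

variable {Ω Ω' : Type*} {mΩ : MeasurableSpace Ω} {mΩ' : MeasurableSpace Ω'} {μ : Measure Ω}
  {μ' : Measure Ω'}

/-- Composing the sequence with the indicator of `C` reduces joint laws to the law of one real
variable, which the isomorphism preserves. -/
theorem FilteredIso.measure_preimage_eq {ι : Type*} [Preorder ι] {ℱ : Filtration ι mΩ}
    {ℱ' : Filtration ι mΩ'} (Φ : FilteredIso μ ℱ μ' ℱ') (X : ℕ → L0 μ (⨆ n, ℱ n))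
    {C : Set (ℕ → ℝ)} (hC : MeasurableSet C) :
    μ' {ω | (fun k => (Φ.toEquiv (X k) : Ω' →ₘ[μ'] ℝ) ω) ∈ C} =
      μ {ω | (fun k => (X k : Ω →ₘ[μ] ℝ) ω) ∈ C} := by
  have hg : Measurable (C.indicator fun _ => (1 : ℝ)) := measurable_const.indicator hC
  obtain ⟨Y, hY⟩ := exists_mem_L0_comp _ (iSup_le ℱ.le) X hg
  have hY' := Φ.map_borel X Y _ hg hY
  have h := congrArg (fun ρ => ρ {(1 : ℝ)}) (Φ.map_law Y)
  rw [Measure.map_apply (AEEqFun.measurable _) (measurableSet_singleton _),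
    Measure.map_apply (AEEqFun.measurable _) (measurableSet_singleton _)] at h
  have hind : ∀ s : ℕ → ℝ, C.indicator (fun _ => (1 : ℝ)) s = 1 ↔ s ∈ C := by
    intro s
    by_cases hs : s ∈ C <;> simp [hs]
  rw [measure_congr (t := {ω | (fun k => (Φ.toEquiv (X k) : Ω' →ₘ[μ'] ℝ) ω) ∈ C}) ?_,
    measure_congr (t := {ω | (fun k => (X k : Ω →ₘ[μ] ℝ) ω) ∈ C}) ?_] at h
  · exact h
  · filter_upwards [hY] with ω hω
    refine propext ?_
    change (Y : Ω →ₘ[μ] ℝ) ω = 1 ↔ _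
    rw [hω]
    exact hind _
  · filter_upwards [hY'] with ω hω
    refine propext ?_
    change (Φ.toEquiv Y : Ω' →ₘ[μ'] ℝ) ω = 1 ↔ _
    rw [hω]
    exact hind _

theorem exists_real_leftInverse (G : Type*) [Fintype G] [Nonempty G] [MeasurableSpace G]
    [MeasurableSingletonClass G] : ∃ c : G → ℝ, ∃ d : ℝ → G, Measurable c ∧ Measurable d ∧
      ∀ y, d (c y) = y := by
  obtain ⟨c, hc⟩ := exists_measurableEmbedding_of_fintype G
  obtain ⟨d, hd, hdc⟩ := hc.exists_measurable_extend (measurable_id (α := G)) fun _ => inferInstance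
  exact ⟨c, d, hc.measurable, hd, fun y => congrFun hdc y⟩

/-- Backward chains are transported by isomorphisms of filtered probability spaces. -/
theorem IsBackwardChain.of_filteredIso [IsProbabilityMeasure μ] [IsProbabilityMeasure μ']
    {κ : Type*} [Preorder κ] {ℱ : Filtration κ mΩ} {ℱ' : Filtration κ mΩ'} {j : ℕ → κ}
    {G E : ℕ → Type*} [∀ k, Fintype (G k)] [∀ k, MeasurableSpace (G k)]
    [∀ k, MeasurableSingletonClass (G k)] {f : ∀ k, G k → E k} {p : ∀ k, G (k + 1) → E k → ℝ}
    {X : ∀ k, Ω → G k} (h : IsBackwardChain μ ℱ j f p X) (Φ : FilteredIso μ ℱ μ' ℱ') :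
    ∃ X' : ∀ k, Ω' → G k, IsBackwardChain μ' ℱ' j f p X' := by
  obtain ⟨ω₀⟩ : Nonempty Ω := nonempty_of_isProbabilityMeasure μ
  have hne : ∀ k, Nonempty (G k) := fun k => ⟨X k ω₀⟩
  choose c d hc hd hdc using fun k => exists_real_leftInverse (G k)
  have hcX : ∀ k, StronglyMeasurable[ℱ (j k)] fun ω => c k (X k ω) := fun k =>
    ((hc k).comp (h.meas k)).stronglyMeasurable
  let Y : ∀ k, L0 μ (⨆ n, ℱ n) := fun k =>
    ⟨AEEqFun.mk (fun ω => c k (X k ω)) ((hcX k).mono (ℱ.le _)).aestronglyMeasurable,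
      _, (hcX k).mono (le_iSup (fun n => (ℱ n : MeasurableSpace Ω)) (j k)),
      AEEqFun.coeFn_mk _ _⟩
  have hY : ∀ k, ((Y k : Ω →ₘ[μ] ℝ) : Ω → ℝ) =ᵐ[μ] fun ω => c k (X k ω) := fun k =>
    AEEqFun.coeFn_mk _ _
  have hY' : ∀ k, (Φ.toEquiv (Y k) : Ω' →ₘ[μ'] ℝ) ∈ L0 μ' (ℱ' (j k)) := fun k =>
    (Φ.map_filtration _ _).2 ⟨_, hcX k, hY k⟩
  -- The images are only classes modulo null sets; `D k` is a version that is exactly measurable at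
  -- time `j k`.
  choose D hD hYD using hY'
  let X' : ∀ k, Ω' → G k := fun k ω => d k (D k ω)
  have hX' : ∀ k, Measurable[ℱ' (j k)] (X' k) := fun k => (hd k).comp (hD k).measurable
  have key : ∀ k B', MeasurableSet[ℱ' (j (k + 1))] B' → ∃ B, MeasurableSet[ℱ (j (k + 1))] B ∧
      ∀ S : Set (G (k + 1) × G k), μ'.real (B' ∩ {ω | (X' (k + 1) ω, X' k ω) ∈ S}) =
        μ.real (B ∩ {ω | (X (k + 1) ω, X k ω) ∈ S}) := by
    intro k B' hB'
    have hind : StronglyMeasurable[ℱ' (j (k + 1))] (B'.indicator fun _ => (1 : ℝ)) :=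
      stronglyMeasurable_const.indicator hB'
    let W' : L0 μ' (⨆ n, ℱ' n) :=
      ⟨AEEqFun.mk _ (hind.mono (ℱ'.le _)).aestronglyMeasurable,
        _, hind.mono (le_iSup (fun n => (ℱ' n : MeasurableSpace Ω')) (j (k + 1))),
        AEEqFun.coeFn_mk _ _⟩
    have hW' : ((W' : Ω' →ₘ[μ'] ℝ) : Ω' → ℝ) =ᵐ[μ'] B'.indicator fun _ => (1 : ℝ) :=
      AEEqFun.coeFn_mk _ _
    let W := Φ.toEquiv.symm W'
    have hΦW : Φ.toEquiv W = W' := Φ.toEquiv.apply_symm_apply W'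
    have hW : (W : Ω →ₘ[μ] ℝ) ∈ L0 μ (ℱ (j (k + 1))) :=
      (Φ.map_filtration _ _).1 (hΦW ▸ ⟨_, hind, hW'⟩)
    obtain ⟨w, hw, hWw⟩ := hW
    refine ⟨w ⁻¹' {1}, hw.measurable (measurableSet_singleton _), fun S => ?_⟩
    -- The transition identity involves only the joint law of an indicator of the past and two
    -- successive values, so these three are transported together.
    let T : ℕ → L0 μ (⨆ n, ℱ n) := fun i => if i = 0 then W else if i = 1 then Y (k + 1) else Y k
    have hC : MeasurableSet {s : ℕ → ℝ | s 0 = 1 ∧ (d (k + 1) (s 1), d k (s 2)) ∈ S} :=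
      (measurable_pi_apply 0 (measurableSet_singleton _)).inter
        ((((hd _).comp (measurable_pi_apply 1)).prodMk ((hd _).comp (measurable_pi_apply 2)))
          S.toFinite.measurableSet)
    have hmap := Φ.measure_preimage_eq T hC
    rw [measureReal_def, measureReal_def]
    congr 1
    refine Eq.trans (measure_congr ?_) (hmap.trans (measure_congr ?_))
    · filter_upwards [hW', hYD k, hYD (k + 1)] with ω h0 h1 h2
      refine propext ?_
      change (ω ∈ B' ∧ (X' (k + 1) ω, X' k ω) ∈ S) ↔ ((Φ.toEquiv W : Ω' →ₘ[μ'] ℝ) ω = 1 ∧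
        (d (k + 1) ((Φ.toEquiv (Y (k + 1)) : Ω' →ₘ[μ'] ℝ) ω),
          d k ((Φ.toEquiv (Y k) : Ω' →ₘ[μ'] ℝ) ω)) ∈ S)
      rw [hΦW, h0, h1, h2]
      refine and_congr_left fun _ => ?_
      by_cases hω : ω ∈ B' <;> simp [hω]
    · filter_upwards [hWw, hY k, hY (k + 1)] with ω h0 h1 h2
      refine propext ?_
      change ((W : Ω →ₘ[μ] ℝ) ω = 1 ∧ (d (k + 1) ((Y (k + 1) : Ω →ₘ[μ] ℝ) ω),
        d k ((Y k : Ω →ₘ[μ] ℝ) ω)) ∈ S) ↔ (w ω = 1 ∧ (X (k + 1) ω, X k ω) ∈ S)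
      rw [h0, h1, h2, hdc, hdc]
  refine ⟨X', hX', fun k B' hB' x z => ?_, fun k x => ?_⟩
  · obtain ⟨B, hB, hBB'⟩ := key k B' hB'
    have h1 := hBB' {q | q.1 = x}
    have h2 := hBB' {q | q.1 = x ∧ f k q.2 = z}
    have h3 := h.trans k B hB x z
    rw [inter_assoc] at h3 ⊢
    exact h2.trans (h3.trans (congrArg (· * p k x z) h1.symm))
  · obtain ⟨B, -, hB⟩ := key k univ MeasurableSet.univ
    have h1 := hB {q | q.2 = x}
    rw [univ_inter] at h1
    exact (h1.trans_le (measureReal_mono inter_subset_right)).trans (h.bound k x)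

end Isomorphism

/-! ### Transport of backward chains by immersions -/

section Immersion

variable {Ω : Type*} {mΩ : MeasurableSpace Ω} {μ : Measure Ω}

/-- Backward chains of a filtration are backward chains of the filtrations into which it is
immersed. -/
theorem IsBackwardChain.of_immersed [IsProbabilityMeasure μ]
    {κ : Type*} [Preorder κ] {ℱ 𝒢 : Filtration κ mΩ} {j : ℕ → κ} (hj : Antitone j)
    {G E : ℕ → Type*} [∀ k, Fintype (G k)] [∀ k, MeasurableSpace (G k)]
    [∀ k, MeasurableSingletonClass (G k)] {f : ∀ k, G k → E k} {p : ∀ k, G (k + 1) → E k → ℝ}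
    {X : ∀ k, Ω → G k} (h : IsBackwardChain μ ℱ j f p X) (him : Immersed μ ℱ 𝒢) :
    IsBackwardChain μ 𝒢 j f p X := by
  refine ⟨fun k => (h.meas k).mono (him.1 _) le_rfl, fun k B hB x z => ?_, h.bound⟩
  have hle : ℱ (j (k + 1)) ≤ mΩ := ℱ.le _
  have hjk : j (k + 1) ≤ j k := hj (Nat.le_succ k)
  have hx : MeasurableSet[ℱ (j (k + 1))] (X (k + 1) ⁻¹' {x}) := h.meas (k + 1) (measurableSet_singleton x)
  have hz : MeasurableSet[ℱ (j k)] {ω | f k (X k ω) = z} :=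
    h.meas k (Set.toFinite {y | f k y = z}).measurableSet
  set Cx := X (k + 1) ⁻¹' {x} with hCx
  set A := Cx ∩ {ω | f k (X k ω) = z} with hA
  have hAm : MeasurableSet[ℱ (j k)] A := (ℱ.mono hjk _ hx).inter hz
  have hA' : MeasurableSet A := ℱ.le _ _ hAm
  have hx' : MeasurableSet Cx := hle _ hx
  have hB' : MeasurableSet B := 𝒢.le _ _ hB
  -- The transition identity in `ℱ` identifies the conditional expectation of the indicator of `A`
  -- as `p k x z` on `Cx` and zero elsewhere. Conditional independence then lets `B` range over the
  -- larger past.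
  have hcA : (fun ω => Cx.indicator (fun _ => p k x z) ω) =ᵐ[μ]
      μ[A.indicator (fun _ => (1 : ℝ)) | ℱ (j (k + 1))] := by
    refine ae_eq_condExp_of_forall_setIntegral_eq hle ((integrable_const _).indicator hA')
      (fun s _ _ => ((integrable_const _).indicator hx').integrableOn) (fun s hs _ => ?_)
      (stronglyMeasurable_const.indicator hx).aestronglyMeasurable
    rw [setIntegral_indicator hx', setIntegral_indicator hA', setIntegral_const,
      setIntegral_const, smul_eq_mul, smul_eq_mul, mul_one, hA, ← inter_assoc, h.trans k s hs x z]
  have him' := him.2 (j (k + 1)) (j k) hjk A B hAm hB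
  have hBint : Integrable (B.indicator fun _ => (1 : ℝ)) μ := (integrable_const _).indicator hB'
  have hcalc : μ.real (A ∩ B) = p k x z * μ.real (Cx ∩ B) := by
    calc μ.real (A ∩ B) = ∫ ω, (A ∩ B).indicator (fun _ => (1 : ℝ)) ω ∂μ := by
          rw [integral_indicator (hA'.inter hB'), setIntegral_const, smul_eq_mul, mul_one]
      _ = ∫ ω, (μ[(A ∩ B).indicator (fun _ => (1 : ℝ)) | ℱ (j (k + 1))]) ω ∂μ := (integral_condExp hle).symm
      _ = ∫ ω, Cx.indicator (fun ω => p k x z * (μ[B.indicator (fun _ => (1 : ℝ)) | ℱ (j (k + 1))]) ω) ω ∂μ := by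
          refine integral_congr_ae ?_
          filter_upwards [him', hcA] with ω h1 h2
          rw [h1, Pi.mul_apply, ← h2]
          by_cases hω : ω ∈ Cx <;> simp [hω]
      _ = p k x z * ∫ ω in Cx, (μ[B.indicator (fun _ => (1 : ℝ)) | ℱ (j (k + 1))]) ω ∂μ := by
          rw [integral_indicator hx', integral_const_mul]
      _ = p k x z * μ.real (Cx ∩ B) := by
          rw [setIntegral_condExp hle hBint hx, setIntegral_indicator hB', setIntegral_const,
            smul_eq_mul, mul_one]
  rw [inter_assoc, inter_comm B, hcalc, inter_comm Cx, mul_comm]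

end Immersion

/-! ### Transfer to the path space of the driving process -/

section PathSpace

/-- The σ-field on the path space generated by the coordinates in `S`. -/
@[reducible] def coordSpace {κ : Type*} (S : Set κ) : MeasurableSpace (κ → ℝ) :=
  MeasurableSpace.comap (fun (w : κ → ℝ) (i : S) => w i) inferInstance

variable {κ : Type*}

theorem measurable_coordSpace_apply {S : Set κ} {i : κ} (hi : i ∈ S) :
    Measurable[coordSpace S] fun w : κ → ℝ => w i :=
  fun s hs => ⟨(fun g : S → ℝ => g ⟨i, hi⟩) ⁻¹' s, measurable_pi_apply _ hs, rfl⟩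

theorem measurable_into_coordSpace {α : Type*} [MeasurableSpace α] {S : Set κ} {Y : α → κ → ℝ}
    (hY : ∀ i ∈ S, Measurable fun a => Y a i) : Measurable[_, coordSpace S] Y := by
  rw [measurable_comap_iff]
  exact measurable_pi_lambda _ fun i => hY i i.2

theorem coordSpace_mono {S T : Set κ} (h : S ⊆ T) :
    (coordSpace S : MeasurableSpace (κ → ℝ)) ≤ coordSpace T :=
  Measurable.comap_le (@measurable_pi_lambda _ _ _ (coordSpace T) _ _
    fun i => measurable_coordSpace_apply (h i.2))

theorem coordSpace_le (S : Set κ) : coordSpace S ≤ (MeasurableSpace.pi : MeasurableSpace (κ → ℝ)) :=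
  Measurable.comap_le (measurable_pi_lambda _ fun _ => measurable_pi_apply _)

theorem mem_iff_of_measurableSet_coordSpace {S : Set κ} {B : Set (κ → ℝ)}
    (hB : MeasurableSet[coordSpace S] B) {w w' : κ → ℝ} (h : ∀ i ∈ S, w i = w' i) :
    w ∈ B ↔ w' ∈ B := by
  obtain ⟨t, -, rfl⟩ := hB
  have : (fun i : S => w i) = fun i : S => w' i := funext fun i => h i i.2
  simp only [mem_preimage, this]

theorem comap_coordSpace {Ω : Type*} (V : κ → Ω → ℝ) (S : Set κ) :
    MeasurableSpace.comap (fun ω i => V i ω) (coordSpace S) =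
      ⨆ i : S, MeasurableSpace.comap (V i) inferInstance := by
  rw [MeasurableSpace.comap_comp, MeasurableSpace.pi, MeasurableSpace.comap_iSup]
  refine iSup_congr fun i => ?_
  rw [MeasurableSpace.comap_comp]
  rfl

variable (κ) in
/-- The filtration generated by the coordinate process. -/
def pathFiltration [Preorder κ] : Filtration κ (MeasurableSpace.pi : MeasurableSpace (κ → ℝ)) where
  seq i := coordSpace (Set.Iic i)
  mono' _ _ h := coordSpace_mono (Set.Iic_subset_Iic.2 h)
  le' _ := coordSpace_le _

/-- A finite-valued random variable known at some time of a natural filtration is almost surely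
a function of the process up to that time. -/
theorem exists_ae_eq_comp_path {Ω : Type*} {mΩ : MeasurableSpace Ω} {μ : Measure Ω}
    {V : κ → Ω → ℝ} {S : Set κ} {G : Type*} [Fintype G] [Nonempty G] [MeasurableSpace G]
    [MeasurableSingletonClass G] {X : Ω → G}
    (hX : Measurable[completed μ (⨆ i : S, MeasurableSpace.comap (V i) inferInstance)] X) :
    ∃ Y : (κ → ℝ) → G, Measurable[coordSpace S] Y ∧ ∀ᵐ ω ∂μ, X ω = Y fun i => V i ω := by
  classical
  obtain ⟨c, d, -, hd, hdc⟩ := exists_real_leftInverse G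
  have hex : ∀ y, ∃ t, MeasurableSet[coordSpace S] t ∧
      (X ⁻¹' {y} : Set Ω) =ᵐ[μ] ((fun ω i => V i ω) ⁻¹' t : Set Ω) := by
    intro y
    obtain ⟨⟨t, ht, hXt⟩, -⟩ := measurableSet_completed_iff.1 (hX (measurableSet_singleton y))
    rw [← comap_coordSpace] at ht
    obtain ⟨u, hu, rfl⟩ := ht
    exact ⟨u, hu, hXt⟩
  choose t ht hXt using hex
  refine ⟨fun w => d (∑ y, (t y).indicator (fun _ => c y) w), hd.comp
    (@Finset.measurable_fun_sum _ _ _ _ _ _ (coordSpace S) _ _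
      fun y _ => measurable_const.indicator (ht y)), ?_⟩
  filter_upwards [ae_all_iff.2 fun y => (hXt y).mem_iff] with ω hω
  replace hω : ∀ y, X ω = y ↔ (fun i => V i ω) ∈ t y := hω
  rw [Finset.sum_eq_single (X ω)]
  · rw [indicator_of_mem ((hω (X ω)).1 rfl), hdc]
  · intro y _ hy
    exact indicator_of_notMem (fun hmem => hy ((hω y).2 hmem).symm) _
  · simp

/-- Each value of the chain is almost surely a function of the driving process, and the chain's
properties depend only on joint laws. -/
theorem IsBackwardChain.exists_path {Ω : Type*} {mΩ : MeasurableSpace Ω} {μ : Measure Ω}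
    [IsProbabilityMeasure μ] [Preorder κ] {V : κ → Ω → ℝ} (hV : ∀ i, Measurable (V i))
    {j : ℕ → κ}
    {G E : ℕ → Type*} [∀ k, Fintype (G k)] [∀ k, MeasurableSpace (G k)]
    [∀ k, MeasurableSingletonClass (G k)] {f : ∀ k, G k → E k} {p : ∀ k, G (k + 1) → E k → ℝ}
    {X : ∀ k, Ω → G k} (h : IsBackwardChain μ (naturalFiltration μ V) j f p X) :
    ∃ Y, IsBackwardChain (μ.map fun ω i => V i ω) (pathFiltration κ) j f p Y := by
  obtain ⟨ω₀⟩ : Nonempty Ω := nonempty_of_isProbabilityMeasure μ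
  have hne : ∀ k, Nonempty (G k) := fun k => ⟨X k ω₀⟩
  choose Y hY hXY using fun k => exists_ae_eq_comp_path (h.meas k)
  have hpath : Measurable fun ω i => V i ω := measurable_pi_lambda _ hV
  have hY' : ∀ k, Measurable (Y k) := fun k => (hY k).mono (coordSpace_le _) le_rfl
  refine ⟨Y, hY, fun k B hB x z => ?_, fun k x => ?_⟩
  · have hB' : MeasurableSet B := coordSpace_le _ _ hB
    have hx : MeasurableSet (Y (k + 1) ⁻¹' {x}) := hY' (k + 1) (measurableSet_singleton x)
    have hz : MeasurableSet {w | f k (Y k w) = z} :=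
      hY' k (Set.toFinite {y | f k y = z}).measurableSet
    rw [map_measureReal_apply hpath ((hB'.inter hx).inter hz),
      map_measureReal_apply hpath (hB'.inter hx)]
    have hBm : MeasurableSet[naturalFiltration μ V (j (k + 1))]
        ((fun ω i => V i ω) ⁻¹' B) := by
      rw [naturalFiltration_apply, ← comap_coordSpace]
      exact le_completed ((MeasurableSpace.comap_mono (coordSpace_le _)).trans hpath.comap_le) _ ⟨B, hB, rfl⟩
    have h0 := h.trans k _ hBm x z
    rw [measureReal_congr (t := (fun ω i => V i ω) ⁻¹' (B ∩ Y (k + 1) ⁻¹' {x} ∩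
        {w | f k (Y k w) = z})) ?_,
      measureReal_congr (s := _ ∩ X (k + 1) ⁻¹' {x})
        (t := (fun ω i => V i ω) ⁻¹' (B ∩ Y (k + 1) ⁻¹' {x})) ?_] at h0
    · exact h0
    · filter_upwards [hXY (k + 1)] with ω h1
      refine propext (and_congr_right fun _ => ?_)
      change X (k + 1) ω = x ↔ Y (k + 1) (fun i => V i ω) = x
      rw [h1]
    · filter_upwards [hXY (k + 1), hXY k] with ω h1 h2
      refine propext (and_congr (and_congr_right fun _ => ?_) ?_)
      · change X (k + 1) ω = x ↔ Y (k + 1) (fun i => V i ω) = x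
        rw [h1]
      · change f k (X k ω) = z ↔ f k (Y k (fun i => V i ω)) = z
        rw [h2]
  · rw [map_measureReal_apply hpath (hY' k (measurableSet_singleton x))]
    refine (measureReal_congr ?_).trans_le (h.bound k x)
    filter_upwards [hXY k] with ω h1
    refine propext ?_
    change Y k (fun i => V i ω) = x ↔ X k ω = x
    rw [h1]

end PathSpace

/-! ### Splicing independent paths -/

section Coupling

/-- The identity is stable under complements, because `univ` satisfies it, and under disjoint
unions: a π-λ argument. -/
theorem real_inter_eq_mul_of_generateFrom {Ω : Type*} {mΩ : MeasurableSpace Ω} {μ : Measure Ω}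
    [IsFiniteMeasure μ] {𝒞 : Set (Set Ω)} (hpi : IsPiSystem 𝒞) (h𝒞 : ∀ s ∈ 𝒞, MeasurableSet s)
    (huniv : univ ∈ 𝒞) {A₁ A₂ : Set Ω} (hA₁ : MeasurableSet A₁) (hA₂ : MeasurableSet A₂) {c : ℝ}
    (h : ∀ B ∈ 𝒞, μ.real (B ∩ A₁) = μ.real (B ∩ A₂) * c) {B : Set Ω}
    (hB : MeasurableSet[MeasurableSpace.generateFrom 𝒞] B) :
    μ.real (B ∩ A₁) = μ.real (B ∩ A₂) * c := by
  have hle : MeasurableSpace.generateFrom 𝒞 ≤ mΩ := MeasurableSpace.generateFrom_le h𝒞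
  induction B, hB using MeasurableSpace.induction_on_inter rfl hpi with
  | empty => simp
  | basic t ht => exact h t ht
  | compl t ht ih =>
    have ht' := hle _ ht
    have hdiff : ∀ A : Set Ω, μ.real (tᶜ ∩ A) = μ.real A - μ.real (t ∩ A) := by
      intro A
      have := measureReal_inter_add_sdiff (μ := μ) (s := A) ht'
      rw [inter_comm tᶜ, inter_comm t, ← sdiff_eq]
      linarith
    have h0 := h univ huniv
    rw [univ_inter, univ_inter] at h0
    rw [hdiff, hdiff, ih, h0]
    ring
  | iUnion s hdisj hs ih =>
    have hsum : ∀ A : Set Ω, MeasurableSet A →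
        HasSum (fun i => μ.real (s i ∩ A)) (μ.real ((⋃ i, s i) ∩ A)) := by
      intro A hA
      rw [iUnion_inter]
      have hd : Pairwise fun i k => Disjoint (s i ∩ A) (s k ∩ A) := fun i k hik =>
        (hdisj hik).mono inter_subset_left inter_subset_left
      rw [measureReal_def, measure_iUnion hd fun i => (hle _ (hs i)).inter hA,
        ENNReal.tsum_toReal_eq fun i => measure_ne_top μ _]
      exact ENNReal.hasSum_toReal (by
        rw [← measure_iUnion hd fun i => (hle _ (hs i)).inter hA]
        exact measure_ne_top μ _)
    have h1 := hsum A₁ hA₁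
    simp_rw [ih] at h1
    exact h1.unique ((hsum A₂ hA₂).mul_right c)

variable {κ : Type*} [LinearOrder κ]

/-- The path that follows `a` up to time `m` and `c` afterwards. -/
def mix (m : κ) (a c : κ → ℝ) : κ → ℝ := fun i => if i ≤ m then a i else c i

theorem measurable_mix (m : κ) :
    Measurable fun q : (κ → ℝ) × (κ → ℝ) => mix m q.1 q.2 := by
  refine measurable_pi_lambda _ fun i => ?_
  unfold mix
  split_ifs
  · exact (measurable_pi_apply i).comp measurable_fst
  · exact (measurable_pi_apply i).comp measurable_snd

/-- On boxes, the coordinates up to `m` and those after `m` contribute separate factors. This is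
where independence of the coordinates is used: replacing the past by an independent copy preserves
the law. -/
theorem map_mix_infinitePi (ρ : κ → Measure ℝ) [∀ i, IsProbabilityMeasure (ρ i)] (m : κ) :
    ((Measure.infinitePi ρ).prod (Measure.infinitePi ρ)).map (fun q => mix m q.1 q.2) =
      Measure.infinitePi ρ := by
  refine Measure.eq_infinitePi _ fun s t ht => ?_
  have hpre : (fun q : (κ → ℝ) × (κ → ℝ) => mix m q.1 q.2) ⁻¹' (Set.pi s t) =
      (Set.pi (s.filter (· ≤ m)) t) ×ˢ (Set.pi (s.filter (¬ · ≤ m)) t) := by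
    ext q
    simp only [mem_preimage, Set.mem_pi, mem_prod, Finset.coe_filter, mem_ofPred_eq, mix,
      Finset.mem_coe]
    constructor
    · intro hq
      refine ⟨fun i hi => ?_, fun i hi => ?_⟩
      · have := hq i hi.1
        rwa [if_pos hi.2] at this
      · have := hq i hi.1
        rwa [if_neg hi.2] at this
    · rintro ⟨h1, h2⟩ i hi
      split_ifs with him
      · exact h1 i ⟨hi, him⟩
      · exact h2 i ⟨hi, him⟩
  rw [Measure.map_apply (measurable_mix m) (MeasurableSet.pi s.countable_toSet fun i _ => ht i),
    hpre, Measure.prod_prod, Measure.infinitePi_pi _ fun i _ => ht i,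
    Measure.infinitePi_pi _ fun i _ => ht i, Finset.prod_filter_mul_prod_filter_not]

end Coupling

/-! ### Two paths with independent pasts and a common future -/

section Coupling

variable {κ : Type*}

section

variable (ρ : κ → Measure ℝ) [∀ i, IsProbabilityMeasure (ρ i)]

/-- The law of the two independent pasts and of the common future. -/
noncomputable def couplingMeasure : Measure ((κ → ℝ) × (κ → ℝ) × (κ → ℝ)) :=
  (Measure.infinitePi ρ).prod ((Measure.infinitePi ρ).prod (Measure.infinitePi ρ))

instance : IsProbabilityMeasure (couplingMeasure ρ) := by
  unfold couplingMeasure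
  infer_instance

theorem map_swap_couplingMeasure :
    (couplingMeasure ρ).map (fun q => (q.2.1, q.1, q.2.2)) = couplingMeasure ρ := by
  have hmeas : Measurable fun q : (κ → ℝ) × (κ → ℝ) × (κ → ℝ) => (q.2.1, q.1, q.2.2) := by
    fun_prop
  have := Measure.isProbabilityMeasure_map (μ := couplingMeasure ρ) hmeas.aemeasurable
  refine Measure.ext_prod₃ fun {s t u} hs ht hu => ?_
  rw [Measure.map_apply hmeas (hs.prod (ht.prod hu))]
  have hpre : (fun q : (κ → ℝ) × (κ → ℝ) × (κ → ℝ) => (q.2.1, q.1, q.2.2)) ⁻¹' (s ×ˢ t ×ˢ u) =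
      t ×ˢ s ×ˢ u := by
    ext q
    simp only [mem_preimage, mem_prod]
    tauto
  rw [hpre, couplingMeasure, Measure.prod_prod, Measure.prod_prod, Measure.prod_prod,
    Measure.prod_prod]
  ring

end

variable [LinearOrder κ]

/-- The first of two coupled paths: they have independent pasts `a`, `b` up to time `m` and a
common future `c`. -/
def leftCopy (m : κ) (q : (κ → ℝ) × (κ → ℝ) × (κ → ℝ)) : κ → ℝ := mix m q.1 q.2.2

/-- The second of two coupled paths. -/
def rightCopy (m : κ) (q : (κ → ℝ) × (κ → ℝ) × (κ → ℝ)) : κ → ℝ := mix m q.2.1 q.2.2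

/-- The boxes that generate the events determined by the two coupled paths up to time `i`. -/
def coupledBoxes (m i : κ) : Set (Set ((κ → ℝ) × (κ → ℝ) × (κ → ℝ))) :=
  {s | ∃ B₁ B₂ B₃, MeasurableSet[coordSpace (Set.Iic m)] B₁ ∧
    MeasurableSet[coordSpace (Set.Iic m)] B₂ ∧ MeasurableSet[coordSpace (Set.Ioc m i)] B₃ ∧
    s = B₁ ×ˢ B₂ ×ˢ B₃}

/-- The events determined by the two coupled paths up to time `i`. -/
@[reducible] def coupledSpace (m i : κ) : MeasurableSpace ((κ → ℝ) × (κ → ℝ) × (κ → ℝ)) :=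
  MeasurableSpace.generateFrom (coupledBoxes m i)

theorem isPiSystem_coupledBoxes (m i : κ) : IsPiSystem (coupledBoxes m i) := by
  rintro _ ⟨B₁, B₂, B₃, h₁, h₂, h₃, rfl⟩ _ ⟨C₁, C₂, C₃, h₁', h₂', h₃', rfl⟩ -
  refine ⟨B₁ ∩ C₁, B₂ ∩ C₂, B₃ ∩ C₃, h₁.inter h₁', h₂.inter h₂', h₃.inter h₃', ?_⟩
  rw [prod_inter_prod, prod_inter_prod]

theorem univ_mem_coupledBoxes (m i : κ) : univ ∈ coupledBoxes m i :=
  ⟨univ, univ, univ, MeasurableSet.univ, MeasurableSet.univ, MeasurableSet.univ, by simp⟩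

theorem measurableSet_of_mem_coupledBoxes {m i : κ} {s : Set ((κ → ℝ) × (κ → ℝ) × (κ → ℝ))}
    (hs : s ∈ coupledBoxes m i) : MeasurableSet s := by
  obtain ⟨B₁, B₂, B₃, h₁, h₂, h₃, rfl⟩ := hs
  exact (coordSpace_le _ _ h₁).prod ((coordSpace_le _ _ h₂).prod (coordSpace_le _ _ h₃))

theorem coupledSpace_le (m i : κ) : coupledSpace m i ≤ Prod.instMeasurableSpace :=
  MeasurableSpace.generateFrom_le fun _ => measurableSet_of_mem_coupledBoxes

theorem measurable_coupledSpace_future {m i l : κ} (hl : l ∈ Set.Ioc m i) :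
    Measurable[coupledSpace m i] fun q : (κ → ℝ) × (κ → ℝ) × (κ → ℝ) => q.2.2 l := fun t ht =>
  MeasurableSpace.measurableSet_generateFrom ⟨univ, univ, _, MeasurableSet.univ,
    MeasurableSet.univ, measurable_coordSpace_apply hl ht, by ext; simp⟩

theorem measurable_leftCopy_coupledSpace (m i : κ) :
    Measurable[coupledSpace m i, coordSpace (Set.Iic i)] (leftCopy m) := by
  refine @measurable_into_coordSpace _ _ (coupledSpace m i) _ _ fun l hl => ?_
  by_cases hlm : l ≤ m
  · simp only [leftCopy, mix, if_pos hlm]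
    exact fun t ht => MeasurableSpace.measurableSet_generateFrom ⟨_, univ, univ,
      measurable_coordSpace_apply (S := Set.Iic m) hlm ht, MeasurableSet.univ,
      MeasurableSet.univ, by ext; simp⟩
  · simp only [leftCopy, mix, if_neg hlm]
    exact measurable_coupledSpace_future ⟨not_le.1 hlm, hl⟩

theorem measurable_rightCopy_coupledSpace (m i : κ) :
    Measurable[coupledSpace m i, coordSpace (Set.Iic i)] (rightCopy m) := by
  refine @measurable_into_coordSpace _ _ (coupledSpace m i) _ _ fun l hl => ?_
  by_cases hlm : l ≤ m
  · simp only [rightCopy, mix, if_pos hlm]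
    exact fun t ht => MeasurableSpace.measurableSet_generateFrom ⟨univ, _, univ,
      MeasurableSet.univ, measurable_coordSpace_apply (S := Set.Iic m) hlm ht,
      MeasurableSet.univ, by ext; simp⟩
  · simp only [rightCopy, mix, if_neg hlm]
    exact measurable_coupledSpace_future ⟨not_le.1 hlm, hl⟩

theorem measurable_leftCopy (m : κ) : Measurable (leftCopy m) :=
  (measurable_mix m).comp (measurable_fst.prodMk (measurable_snd.comp measurable_snd))

theorem measurable_rightCopy (m : κ) : Measurable (rightCopy m) :=
  (measurable_mix m).comp measurable_snd

theorem mix_mem_inter_iff {m i : κ} {B₁ B₃ : Set (κ → ℝ)}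
    (h₁ : MeasurableSet[coordSpace (Set.Iic m)] B₁)
    (h₃ : MeasurableSet[coordSpace (Set.Ioc m i)] B₃) (a c : κ → ℝ) :
    mix m a c ∈ B₁ ∩ B₃ ↔ a ∈ B₁ ∧ c ∈ B₃ := by
  refine and_congr (mem_iff_of_measurableSet_coordSpace h₁ fun l hl => ?_)
    (mem_iff_of_measurableSet_coordSpace h₃ fun l hl => ?_)
  · exact if_pos hl
  · exact if_neg (not_le.2 hl.1)

variable (ρ : κ → Measure ℝ) [∀ i, IsProbabilityMeasure (ρ i)]

/-- Membership in `B₂` and `B₃` can be read on the right copy, which has the law of a single path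
and is independent of the left past. -/
theorem real_box_inter_rightCopy {m i : κ} {B₁ B₂ B₃ A : Set (κ → ℝ)}
    (h₂ : MeasurableSet[coordSpace (Set.Iic m)] B₂)
    (h₃ : MeasurableSet[coordSpace (Set.Ioc m i)] B₃) (hA : MeasurableSet A) :
    (couplingMeasure ρ).real (B₁ ×ˢ B₂ ×ˢ B₃ ∩ rightCopy m ⁻¹' A) =
      (Measure.infinitePi ρ).real B₁ * (Measure.infinitePi ρ).real (B₂ ∩ B₃ ∩ A) := by
  have hset : B₁ ×ˢ B₂ ×ˢ B₃ ∩ rightCopy m ⁻¹' A =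
      B₁ ×ˢ ((fun q : (κ → ℝ) × (κ → ℝ) => mix m q.1 q.2) ⁻¹' (B₂ ∩ B₃ ∩ A)) := by
    ext q
    have := mix_mem_inter_iff h₂ h₃ q.2.1 q.2.2
    simp only [mem_inter_iff, mem_prod, mem_preimage, rightCopy] at this ⊢
    tauto
  rw [hset, couplingMeasure, measureReal_prod_prod, ← map_measureReal_apply (measurable_mix m)
    (((coordSpace_le _ _ h₂).inter (coordSpace_le _ _ h₃)).inter hA), map_mix_infinitePi]

theorem real_box_inter_leftCopy {m i : κ} {B₁ B₂ B₃ A : Set (κ → ℝ)}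
    (h₁ : MeasurableSet[coordSpace (Set.Iic m)] B₁)
    (h₂ : MeasurableSet[coordSpace (Set.Iic m)] B₂)
    (h₃ : MeasurableSet[coordSpace (Set.Ioc m i)] B₃) (hA : MeasurableSet A) :
    (couplingMeasure ρ).real (B₁ ×ˢ B₂ ×ˢ B₃ ∩ leftCopy m ⁻¹' A) =
      (Measure.infinitePi ρ).real B₂ * (Measure.infinitePi ρ).real (B₁ ∩ B₃ ∩ A) := by
  rw [← real_box_inter_rightCopy ρ h₁ h₃ hA, ← map_swap_couplingMeasure ρ,
    map_measureReal_apply (by fun_prop) (((coordSpace_le _ _ h₁).prod ((coordSpace_le _ _ h₂).prod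
      (coordSpace_le _ _ h₃))).inter (measurable_leftCopy m hA)), map_swap_couplingMeasure ρ]
  congr 1
  ext q
  simp only [mem_inter_iff, mem_prod, mem_preimage, rightCopy, leftCopy]
  tauto

/-- Knowing both pasts and the shared coordinates up to `i` gives no more about the future of one
copy than knowing that copy up to `i`. So each copy keeps its transition probabilities in the joint
filtration; on boxes this is the identity `h` for a single path. -/
theorem real_inter_copy_eq_mul {m i : κ} (hmi : m ≤ i) {A₁ A₂ : Set (κ → ℝ)}
    (hA₁ : MeasurableSet A₁) (hA₂ : MeasurableSet A₂) {c : ℝ}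
    (h : ∀ D, MeasurableSet[coordSpace (Set.Iic i)] D → (Measure.infinitePi ρ).real (D ∩ A₁) =
      (Measure.infinitePi ρ).real (D ∩ A₂) * c)
    {B : Set ((κ → ℝ) × (κ → ℝ) × (κ → ℝ))} (hB : MeasurableSet[coupledSpace m i] B) :
    (couplingMeasure ρ).real (B ∩ leftCopy m ⁻¹' A₁) =
        (couplingMeasure ρ).real (B ∩ leftCopy m ⁻¹' A₂) * c ∧
      (couplingMeasure ρ).real (B ∩ rightCopy m ⁻¹' A₁) =
        (couplingMeasure ρ).real (B ∩ rightCopy m ⁻¹' A₂) * c := by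
  have hD : ∀ B₁ B₃ : Set (κ → ℝ), MeasurableSet[coordSpace (Set.Iic m)] B₁ →
      MeasurableSet[coordSpace (Set.Ioc m i)] B₃ →
      MeasurableSet[coordSpace (Set.Iic i)] (B₁ ∩ B₃) := fun B₁ B₃ h₁ h₃ =>
    (coordSpace_mono (Set.Iic_subset_Iic.2 hmi) _ h₁).inter
      (coordSpace_mono (fun l hl => hl.2) _ h₃)
  refine ⟨real_inter_eq_mul_of_generateFrom (isPiSystem_coupledBoxes m i)
    (fun _ => measurableSet_of_mem_coupledBoxes) (univ_mem_coupledBoxes m i)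
    (measurable_leftCopy m hA₁) (measurable_leftCopy m hA₂) ?_ hB,
    real_inter_eq_mul_of_generateFrom (isPiSystem_coupledBoxes m i)
    (fun _ => measurableSet_of_mem_coupledBoxes) (univ_mem_coupledBoxes m i)
    (measurable_rightCopy m hA₁) (measurable_rightCopy m hA₂) ?_ hB⟩
  · rintro _ ⟨B₁, B₂, B₃, h₁, h₂, h₃, rfl⟩
    rw [real_box_inter_leftCopy ρ h₁ h₂ h₃ hA₁, real_box_inter_leftCopy ρ h₁ h₂ h₃ hA₂,
      h _ (hD _ _ h₁ h₃), mul_assoc]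
  · rintro _ ⟨B₁, B₂, B₃, h₁, h₂, h₃, rfl⟩
    rw [real_box_inter_rightCopy ρ h₂ h₃ hA₁, real_box_inter_rightCopy ρ h₂ h₃ hA₂,
      h _ (hD _ _ h₂ h₃), mul_assoc]

theorem real_preimage_copy (m : κ) {A : Set (κ → ℝ)} (hA : MeasurableSet A) :
    (couplingMeasure ρ).real (leftCopy m ⁻¹' A) = (Measure.infinitePi ρ).real A ∧
      (couplingMeasure ρ).real (rightCopy m ⁻¹' A) = (Measure.infinitePi ρ).real A := by
  have h1 := real_box_inter_leftCopy ρ (m := m) (i := m) (B₁ := univ) (B₂ := univ) (B₃ := univ)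
    MeasurableSet.univ MeasurableSet.univ MeasurableSet.univ hA
  have h2 := real_box_inter_rightCopy ρ (m := m) (i := m) (B₁ := univ) (B₂ := univ) (B₃ := univ)
    MeasurableSet.univ MeasurableSet.univ hA
  simp only [univ_prod_univ, univ_inter, probReal_univ, one_mul] at h1 h2
  exact ⟨h1, h2⟩

variable {ρ}
variable {j : ℕ → κ} {G E : ℕ → Type*} [∀ k, Fintype (G k)] [∀ k, MeasurableSpace (G k)]
    [∀ k, MeasurableSingletonClass (G k)] {f : ∀ k, G k → E k} {p : ∀ k, G (k + 1) → E k → ℝ}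
    {Y : ∀ k, (κ → ℝ) → G k}

/-- Two coupled chains that differ at one time coincide at the next time with small probability. -/
theorem IsBackwardChain.real_coupled_step
    (h : IsBackwardChain (Measure.infinitePi ρ) (pathFiltration κ) j f p Y) {m : κ} {k : ℕ}
    (hmk : m ≤ j (k + 1)) [Fintype (E k)] {ε : ℝ} (hε : 0 ≤ ε)
    (hp : ∀ x x', x ≠ x' → ∑ z, min (p k x z) (p k x' z) ≤ ε) :
    (couplingMeasure ρ).real {q | Y (k + 1) (leftCopy m q) ≠ Y (k + 1) (rightCopy m q)} ≤
      (couplingMeasure ρ).real {q | Y k (leftCopy m q) ≠ Y k (rightCopy m q)} + ε := by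
  classical
  set Q := couplingMeasure ρ
  have hY : ∀ k, Measurable (Y k) := fun k => (h.meas k).mono (coordSpace_le _) le_rfl
  have hYl : ∀ k, Measurable fun q => Y k (leftCopy m q) := fun k =>
    (hY k).comp (measurable_leftCopy m)
  have hYr : ∀ k, Measurable fun q => Y k (rightCopy m q) := fun k =>
    (hY k).comp (measurable_rightCopy m)
  -- The only way for the discrepancy to vanish: the values at `k + 1` differ but the images under
  -- `f k` agree.
  let L : Set ((κ → ℝ) × (κ → ℝ) × (κ → ℝ)) :=
    {q | Y (k + 1) (leftCopy m q) ≠ Y (k + 1) (rightCopy m q) ∧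
      f k (Y k (leftCopy m q)) = f k (Y k (rightCopy m q))}
  let W : (κ → ℝ) × (κ → ℝ) × (κ → ℝ) → G (k + 1) × G (k + 1) := fun q =>
    (Y (k + 1) (leftCopy m q), Y (k + 1) (rightCopy m q))
  have hW : Measurable[coupledSpace m (j (k + 1))] W :=
    ((h.meas (k + 1)).comp (measurable_leftCopy_coupledSpace m _)).prodMk
      ((h.meas (k + 1)).comp (measurable_rightCopy_coupledSpace m _))
  have hW' : Measurable W := hW.mono (coupledSpace_le _ _) le_rfl
  have hL : MeasurableSet L :=
    (((hYl (k + 1)).prodMk (hYr (k + 1))) (Set.toFinite {y : G (k + 1) × G (k + 1) | y.1 ≠ y.2}).measurableSet).inter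
      (((hYl k).prodMk (hYr k)) (Set.toFinite {y : G k × G k | f k y.1 = f k y.2}).measurableSet)
  have hLε : Q.real L ≤ ε := by
    have hterm : ∀ y, Q.real (L ∩ W ⁻¹' {y}) ≤ Q.real (W ⁻¹' {y}) * ε := by
      rintro ⟨x, x'⟩
      by_cases hx : x = x'
      · have hempty : L ∩ W ⁻¹' {(x, x')} = ∅ := by
          refine eq_empty_of_forall_notMem fun q hq => hq.1.1 ?_
          have h2 : W q = (x, x') := hq.2
          exact (congrArg Prod.fst h2).trans (hx.trans (congrArg Prod.snd h2).symm)
        rw [hempty, measureReal_empty]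
        positivity
      have hWx : MeasurableSet[coupledSpace m (j (k + 1))] (W ⁻¹' {(x, x')}) :=
        hW (measurableSet_singleton _)
      have hfz : ∀ z, MeasurableSet {w | f k (Y k w) = z} := fun z =>
        hY k (Set.toFinite {y | f k y = z}).measurableSet
      -- On `L`, if the left image is `z` then so is the right one. The probability is thus bounded
      -- by both transition probabilities, without any knowledge of their joint law.
      have hz : ∀ z, Q.real (L ∩ W ⁻¹' {(x, x')} ∩ {q | f k (Y k (leftCopy m q)) = z}) ≤
          Q.real (W ⁻¹' {(x, x')}) * min (p k x z) (p k x' z) := by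
        intro z
        have key : ∀ x, ∀ D, MeasurableSet[coordSpace (Set.Iic (j (k + 1)))] D →
            (Measure.infinitePi ρ).real (D ∩ (Y (k + 1) ⁻¹' {x} ∩ {w | f k (Y k w) = z})) =
              (Measure.infinitePi ρ).real (D ∩ Y (k + 1) ⁻¹' {x}) * p k x z := by
          intro x D hD
          rw [← inter_assoc]
          exact h.trans k D hD x z
        have hYx : ∀ x, MeasurableSet (Y (k + 1) ⁻¹' {x}) := fun x =>
          hY (k + 1) (measurableSet_singleton x)
        have hl := (real_inter_copy_eq_mul ρ hmk ((hYx x).inter (hfz z)) (hYx x) (key x) hWx).1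
        have hr := (real_inter_copy_eq_mul ρ hmk ((hYx x').inter (hfz z)) (hYx x') (key x') hWx).2
        have hl' : W ⁻¹' {(x, x')} ∩ leftCopy m ⁻¹' (Y (k + 1) ⁻¹' {x}) = W ⁻¹' {(x, x')} :=
          inter_eq_left.2 fun q hq => congrArg Prod.fst (show W q = (x, x') from hq)
        have hr' : W ⁻¹' {(x, x')} ∩ rightCopy m ⁻¹' (Y (k + 1) ⁻¹' {x'}) = W ⁻¹' {(x, x')} :=
          inter_eq_left.2 fun q hq => congrArg Prod.snd (show W q = (x, x') from hq)
        rw [hl'] at hl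
        rw [hr'] at hr
        rw [mul_min_of_nonneg _ _ measureReal_nonneg, ← hl, ← hr]
        refine le_min (measureReal_mono ?_) (measureReal_mono ?_)
        · rintro q ⟨⟨-, hq⟩, hqz⟩
          exact ⟨hq, congrArg Prod.fst (show W q = (x, x') from hq), hqz⟩
        · rintro q ⟨⟨hqL, hq⟩, hqz⟩
          exact ⟨hq, congrArg Prod.snd (show W q = (x, x') from hq), hqL.2.symm.trans hqz⟩
      have hcover : L ∩ W ⁻¹' {(x, x')} ⊆ ⋃ z ∈ (Finset.univ : Finset (E k)),
          (L ∩ W ⁻¹' {(x, x')} ∩ {q | f k (Y k (leftCopy m q)) = z}) := fun q hq =>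
        mem_iUnion₂.2 ⟨_, Finset.mem_univ _, hq, rfl⟩
      calc Q.real (L ∩ W ⁻¹' {(x, x')})
          ≤ ∑ z, Q.real (L ∩ W ⁻¹' {(x, x')} ∩ {q | f k (Y k (leftCopy m q)) = z}) :=
            (measureReal_mono hcover (measure_ne_top Q _)).trans (measureReal_biUnion_finset_le _ _)
        _ ≤ ∑ z, Q.real (W ⁻¹' {(x, x')}) * min (p k x z) (p k x' z) :=
            Finset.sum_le_sum fun z _ => hz z
        _ ≤ Q.real (W ⁻¹' {(x, x')}) * ε := by
            rw [← Finset.mul_sum]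
            exact mul_le_mul_of_nonneg_left (hp x x' hx) measureReal_nonneg
    have hone := real_eq_sum_inter_preimage (μ := Q) hW' MeasurableSet.univ
    simp only [univ_inter, probReal_univ] at hone
    calc Q.real L = ∑ y, Q.real (L ∩ W ⁻¹' {y}) := real_eq_sum_inter_preimage hW' hL
      _ ≤ ∑ y, Q.real (W ⁻¹' {y}) * ε := Finset.sum_le_sum fun y _ => hterm y
      _ = ε := by rw [← Finset.sum_mul, ← hone, one_mul]
  refine (measureReal_mono (s₂ := {q | Y k (leftCopy m q) ≠ Y k (rightCopy m q)} ∪ L) ?_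
    (measure_ne_top Q _)).trans ((measureReal_union_le _ _).trans (by gcongr))
  intro q hq
  by_cases hk : Y k (leftCopy m q) = Y k (rightCopy m q)
  · exact Or.inr ⟨hq, congrArg (f k) hk⟩
  · exact Or.inl hk

/-- `Y n` reads only coordinates up to `j n`, where the copies are independent. They agree with
probability the sum of the squared atoms, which is at most the largest atom. -/
theorem IsBackwardChain.half_le_real_ne
    (h : IsBackwardChain (Measure.infinitePi ρ) (pathFiltration κ) j f p Y) (n : ℕ) :
    1 / 2 ≤ (couplingMeasure ρ).real
      {q | Y n (leftCopy (j n) q) ≠ Y n (rightCopy (j n) q)} := by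
  set ν := Measure.infinitePi ρ
  set Q := couplingMeasure ρ
  set m := j n
  have hY : ∀ x, MeasurableSet[coordSpace (Set.Iic m)] (Y n ⁻¹' {x}) := fun x =>
    h.meas n (measurableSet_singleton x)
  have hY' : Measurable (Y n) := (h.meas n).mono (coordSpace_le _) le_rfl
  have hone := real_eq_sum_inter_preimage (μ := ν) hY' MeasurableSet.univ
  simp only [univ_inter, probReal_univ] at hone
  have hcover : (univ : Set ((κ → ℝ) × (κ → ℝ) × (κ → ℝ))) ⊆
      {q | Y n (leftCopy m q) ≠ Y n (rightCopy m q)} ∪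
        ⋃ x ∈ (Finset.univ : Finset (G n)), (Y n ⁻¹' {x}) ×ˢ (Y n ⁻¹' {x}) ×ˢ univ := by
    intro q _
    by_cases hq : Y n (leftCopy m q) = Y n (rightCopy m q)
    · refine Or.inr (mem_iUnion₂.2 ⟨Y n (leftCopy m q), Finset.mem_univ _, ?_, ?_, mem_univ _⟩)
      · refine (mem_iff_of_measurableSet_coordSpace (hY _) fun l hl => ?_).2 (rfl : leftCopy m q ∈ _)
        exact (if_pos hl).symm
      · refine (mem_iff_of_measurableSet_coordSpace (hY _) fun l hl => ?_).2
          (hq.symm : rightCopy m q ∈ _)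
        exact (if_pos hl).symm
    · exact Or.inl hq
  have h1 := (measureReal_mono (μ := Q) hcover).trans (measureReal_union_le _ _)
  have h2 : Q.real (⋃ x ∈ (Finset.univ : Finset (G n)),
      (Y n ⁻¹' {x}) ×ˢ (Y n ⁻¹' {x}) ×ˢ univ) ≤ 1 / 2 := by
    refine (measureReal_biUnion_finset_le _ _).trans ?_
    calc ∑ x, Q.real ((Y n ⁻¹' {x}) ×ˢ (Y n ⁻¹' {x}) ×ˢ univ)
        = ∑ x, ν.real (Y n ⁻¹' {x}) * ν.real (Y n ⁻¹' {x}) := by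
          refine Finset.sum_congr rfl fun x _ => ?_
          change (couplingMeasure ρ).real _ = _
          rw [couplingMeasure, measureReal_prod_prod, measureReal_prod_prod, probReal_univ, mul_one]
      _ ≤ ∑ x, ν.real (Y n ⁻¹' {x}) * (1 / 2) := Finset.sum_le_sum fun x _ =>
          mul_le_mul_of_nonneg_left (h.bound n x) measureReal_nonneg
      _ = 1 / 2 := by rw [← Finset.sum_mul, ← hone, one_mul]
  rw [probReal_univ] at h1
  linarith

/-- Coupled chains that share a long enough future coincide with large probability. -/
theorem exists_real_ne_copies_lt {G : Type*} [Fintype G] [MeasurableSpace G]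
    [MeasurableSingletonClass G] {Y : (κ → ℝ) → G} (hY : Measurable Y)
    (hj : ∀ i, ∃ n, ∀ n' ≥ n, j n' < i) {ε : ℝ} (hε : 0 < ε) :
    ∃ n, (couplingMeasure ρ).real {q | Y (leftCopy (j n) q) ≠ Y (rightCopy (j n) q)} < ε := by
  classical
  set ν := Measure.infinitePi ρ
  set Q := couplingMeasure ρ
  -- Each of the `card G` values costs `2 * δ`, one `δ` per copy; the added 1 makes the total
  -- strictly less than `ε` and covers a zero cardinal.
  set δ := ε / (2 * (Fintype.card G + 1)) with hδ
  have hδ0 : 0 < δ := by positivity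
  have hdense := Measure.MeasureDense.of_generateFrom_isSetAlgebra_finite (μ := ν)
    (isSetAlgebra_measurableCylinders (α := fun _ : κ => ℝ))
    (generateFrom_measurableCylinders (α := fun _ : κ => ℝ)).symm
  have happrox : ∀ y, ∃ I : Finset κ, ∃ B : Set (κ → ℝ), MeasurableSet B ∧
      (∀ w w' : κ → ℝ, (∀ i ∈ I, w i = w' i) → (w ∈ B ↔ w' ∈ B)) ∧
      ν.real (symmDiff (Y ⁻¹' {y}) B) < δ := by
    intro y
    obtain ⟨B, hB, hBδ⟩ := hdense.approx (Y ⁻¹' {y}) (hY (measurableSet_singleton y))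
      (measure_ne_top ν _) δ hδ0
    have hBm := hdense.measurable B hB
    obtain ⟨I, S, -, rfl⟩ := (mem_measurableCylinders _).1 hB
    refine ⟨I, _, hBm, fun w w' hww' => ?_, ?_⟩
    · have : I.restrict w = I.restrict w' := funext fun i => hww' i i.2
      simp only [mem_cylinder, this]
    · exact (ENNReal.lt_ofReal_iff_toReal_lt (measure_ne_top ν _)).1 hBδ
  choose I B hBm hBI hBδ using happrox
  -- The splicing time is pushed before every coordinate used by the approximating cylinders, so
  -- that both copies agree on all of them.
  obtain ⟨n, hn⟩ : ∃ n, ∀ i ∈ Finset.univ.biUnion I, j n < i := by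
    choose N hN using hj
    exact ⟨(Finset.univ.biUnion I).sup N, fun i hi => hN i _ (Finset.le_sup hi)⟩
  refine ⟨n, ?_⟩
  set m := j n
  have hsym : ∀ y q, leftCopy m q ∈ B y ↔ rightCopy m q ∈ B y := by
    intro y q
    refine hBI y _ _ fun i hi => ?_
    have him := not_le.2 (hn i (Finset.mem_biUnion.2 ⟨y, Finset.mem_univ _, hi⟩))
    exact (if_neg him).trans (if_neg him).symm
  have hcover : {q | Y (leftCopy m q) ≠ Y (rightCopy m q)} ⊆ ⋃ y ∈ (Finset.univ : Finset G),
      (leftCopy m ⁻¹' (symmDiff (Y ⁻¹' {y}) (B y)) ∪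
        rightCopy m ⁻¹' (symmDiff (Y ⁻¹' {y}) (B y))) := by
    intro q hq
    refine mem_iUnion₂.2 ⟨Y (leftCopy m q), Finset.mem_univ _, ?_⟩
    have hr : rightCopy m q ∉ Y ⁻¹' {Y (leftCopy m q)} := fun hmem => hq (Eq.symm hmem)
    by_cases hB : leftCopy m q ∈ B (Y (leftCopy m q))
    · exact Or.inr (Or.inr ⟨(hsym _ _).1 hB, hr⟩)
    · exact Or.inl (Or.inl ⟨rfl, hB⟩)
  have hterm : ∀ y, Q.real (leftCopy m ⁻¹' (symmDiff (Y ⁻¹' {y}) (B y)) ∪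
        rightCopy m ⁻¹' (symmDiff (Y ⁻¹' {y}) (B y))) ≤ 2 * δ := by
    intro y
    have hmeas : MeasurableSet (symmDiff (Y ⁻¹' {y}) (B y)) :=
      (hY (measurableSet_singleton y)).symmDiff (hBm y)
    have h2 := real_preimage_copy ρ m hmeas
    refine (measureReal_union_le _ _).trans ?_
    rw [h2.1, h2.2]
    linarith [(hBδ y).le]
  calc Q.real {q | Y (leftCopy m q) ≠ Y (rightCopy m q)}
      ≤ ∑ y : G, 2 * δ := ((measureReal_mono hcover (measure_ne_top Q _)).trans
        (measureReal_biUnion_finset_le _ _)).trans (Finset.sum_le_sum fun y _ => hterm y)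
    _ = Fintype.card G * (2 * δ) := by rw [Finset.sum_const, nsmul_eq_mul, Finset.card_univ]
    _ < (Fintype.card G + 1) * (2 * δ) := by nlinarith
    _ = ε := by rw [hδ]; field_simp

/-- Iterating the one-step bound from `n` down to 0 gives 1/2 ≤ P(values differ at 0) + 1/4, while
that probability is less than 1/4 for a suitable `n`. -/
theorem IsBackwardChain.false_of_path
    (h : IsBackwardChain (Measure.infinitePi ρ) (pathFiltration κ) j f p Y) (hj : StrictAnti j)
    (hj' : ∀ i, ∃ n, j n < i) [∀ k, Fintype (E k)] {ε : ℕ → ℝ} (hε : ∀ k, 0 ≤ ε k)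
    (hsum : ∀ n, ∑ k ∈ Finset.range n, ε k ≤ 1 / 4)
    (hp : ∀ k x x', x ≠ x' → ∑ z, min (p k x z) (p k x' z) ≤ ε k) : False := by
  have hj'' : ∀ i, ∃ n, ∀ n' ≥ n, j n' < i := fun i => by
    obtain ⟨n, hn⟩ := hj' i
    exact ⟨n, fun n' hn' => (hj.antitone hn').trans_lt hn⟩
  obtain ⟨n, hn⟩ := exists_real_ne_copies_lt (ρ := ρ)
    ((h.meas 0).mono (coordSpace_le _) le_rfl) hj'' (show (0 : ℝ) < 1 / 4 by norm_num)
  have hstep : ∀ k ≤ n, (couplingMeasure ρ).real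
      {q | Y k (leftCopy (j n) q) ≠ Y k (rightCopy (j n) q)} ≤
      (couplingMeasure ρ).real {q | Y 0 (leftCopy (j n) q) ≠ Y 0 (rightCopy (j n) q)} +
        ∑ i ∈ Finset.range k, ε i := by
    intro k hk
    induction k with
    | zero => simp
    | succ k ih =>
      rw [Finset.sum_range_succ]
      have := h.real_coupled_step (m := j n) (hj.antitone hk) (hε k) (hp k)
      linarith [ih (by omega)]
  linarith [hstep n le_rfl, h.half_le_real_ne n, hsum n]

/-- A filtration with a backward chain whose conditional laws at successive times have summable
overlaps is not standard. -/
theorem IsBackwardChain.not_isStandard {Ω : Type*} {mΩ : MeasurableSpace Ω} {μ : Measure Ω}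
    [IsProbabilityMeasure μ] {ℱ : Filtration κ mΩ} {X : ∀ k, Ω → G k}
    (h : IsBackwardChain μ ℱ j f p X) (hj : StrictAnti j)
    (hj' : ∀ i, ∃ n, j n < i) [∀ k, Fintype (E k)] {ε : ℕ → ℝ} (hε : ∀ k, 0 ≤ ε k)
    (hsum : ∀ n, ∑ k ∈ Finset.range n, ε k ≤ 1 / 4)
    (hp : ∀ k x x', x ≠ x' → ∑ z, min (p k x z) (p k x' z) ≤ ε k) : ¬ IsStandard μ ℱ := by
  rintro ⟨Ω', mΩ', μ', ℱ', 𝒢, hμ', ⟨V, hV, hind, rfl⟩, ⟨Φ⟩, him⟩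
  obtain ⟨X', hX'⟩ := h.of_filteredIso Φ
  obtain ⟨Y, hY⟩ := (hX'.of_immersed hj.antitone him).exists_path hV
  have hlaw := (iIndepFun_iff_map_fun_eq_infinitePi_map hV).1 hind
  rw [hlaw] at hY
  have := fun i => Measure.isProbabilityMeasure_map (μ := μ') (hV i).aemeasurable
  exact hY.false_of_path hj hj' hε hsum hp

end Coupling

/-! ### Brick chains with finitely many odd times skipped -/

section Main

variable {Ω : Type*} {mΩ : MeasurableSpace Ω} {μ : Measure Ω} {F : ℤ → Type*}
  [∀ n, Fintype (F n)] [∀ n, MeasurableSpace (F n)] [∀ n, MeasurableSingletonClass (F n)]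
  {Z : ∀ n, Ω → F n} {r : ℤ → ℕ} {α : ℤ → ℝ}

/-- The times are variables with equations so that the transition and overlap properties apply to
indices written differently, despite the dependent types. -/
theorem IsBrickChain.real_inter_of_eq [IsProbabilityMeasure μ] (h : IsBrickChain μ Z r α)
    {n m i : ℤ} (hn : n ≤ 0) (hm : m = 2 * n - 1) (hi : i = 2 * n) :
    (∀ B, MeasurableSet[naturalFiltration μ Z m] B → ∀ x z,
      μ.real (B ∩ Z m ⁻¹' {x} ∩ Z i ⁻¹' {z}) =
        μ.real (B ∩ Z m ⁻¹' {x}) * condProb μ (Z i) (Z m) z x) ∧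
    ∀ x x' : F m, x ≠ x' →
      ∑ z, min (condProb μ (Z i) (Z m) z x) (condProb μ (Z i) (Z m) z x') ≤ α n := by
  subst hm hi
  exact ⟨fun B hB x z => h.real_inter_even hn hB x z, (h.brick n hn).overlap⟩

theorem exists_sum_range_le {a : ℕ → ℝ} (ha : Summable a) (ha0 : ∀ k, 0 ≤ a k) {δ : ℝ}
    (hδ : 0 < δ) (K : ℕ) : ∃ M ≥ K, ∀ n, ∑ k ∈ Finset.range n, a (k + M) ≤ δ := by
  obtain ⟨M, hM, hMK⟩ :=
    (((tendsto_sum_nat_add a).eventually_lt_const hδ).and (eventually_ge_atTop K)).exists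
  exact ⟨M, hMK, fun n => (((summable_nat_add_iff M).2 ha).sum_le_tsum _
    fun k _ => ha0 _).trans hM.le⟩

theorem IsBrickChain.not_isStandard_reindex [IsProbabilityMeasure μ] (h : IsBrickChain μ Z r α)
    (hF : ∀ n ≤ 0, 2 ≤ Fintype.card (F n)) (hα : ∀ n ≤ 0, 0 ≤ α n)
    (hsum : Summable fun n : Set.Iic (0 : ℤ) => α n)
    {κ : Type*} [LinearOrder κ] {φ : κ → ℤ} (hφ : StrictMono φ)
    (hfin : {n : ℤ | n ≤ 0 ∧ 2 * n - 1 ∉ Set.range φ}.Finite) :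
    ¬ IsStandard μ (reindex (naturalFiltration μ Z) φ hφ.monotone) := by
  obtain ⟨N, hN⟩ := hfin.bddBelow
  have ha : Summable fun k : ℕ => α (-(k : ℤ)) := by
    refine hsum.comp_injective (i := fun k : ℕ => (⟨-(k : ℤ), by simp⟩ : Set.Iic (0 : ℤ))) ?_
    intro k l hkl
    simpa using hkl
  -- `M` starts the chain far enough back for the remaining overlaps to sum to at most 1/4 and, by
  -- the bound `N.natAbs + 2`, for all `t k` to lie below `N`, where no odd time is skipped.
  obtain ⟨M, hMK, hM⟩ := exists_sum_range_le ha (fun k => hα _ (by omega))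
    (show (0 : ℝ) < 1 / 4 by norm_num) (N.natAbs + 2)
  let t : ℕ → ℤ := fun k => -((k : ℤ) + M) + 1
  have ht : ∀ k, t k = -((k : ℤ) + M) + 1 := fun _ => rfl
  have ht1 : ∀ k, t (k + 1) = t k - 1 := fun k => by rw [ht, ht]; push_cast; ring
  have ht0 : ∀ k, t k ≤ 0 := fun k => by have := ht k; omega
  have hrange : ∀ k, ∃ i, φ i = 2 * t k - 1 := by
    intro k
    by_contra hcon
    have := hN (show t k ∈ _ from ⟨ht0 k, hcon⟩)
    have := ht k
    omega
  choose j hj using hrange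
  have hjanti : StrictAnti j := fun a b hab => by
    rw [← hφ.lt_iff_lt, hj, hj, ht, ht]
    omega
  choose f hf using fun k => (h.brick (t k) (ht0 k)).eq_fun₀
  have hlaw := fun k => h.real_inter_of_eq (n := t k - 1) (m := 2 * t (k + 1) - 1)
    (i := 2 * t k - 2) (by have := ht0 k; omega) (by rw [ht1]) (by ring)
  -- `X k` is the odd value `Z (2 * t k - 1)`, and `f k` recovers the even value just before it.
  -- That value ends the preceding brick, of index `t k - 1`, so the overlap at step `k` is `α (t k
  -- - 1)`, that is `α (-(k + M))`.
  have hchain : IsBackwardChain (G := fun k => F (2 * t k - 1)) (E := fun k => F (2 * t k - 2)) μ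
      (reindex (naturalFiltration μ Z) φ hφ.monotone) j f
      (fun k x z => condProb μ (Z (2 * t k - 2)) (Z (2 * t (k + 1) - 1)) z x)
      (fun k => Z (2 * t k - 1)) := by
    refine ⟨fun k => ?_, fun k B hB x z => ?_, fun k x => ?_⟩
    · exact (comap_measurable _).mono (h.comap_le_naturalFiltration (hj k).ge
        (by have := ht0 k; omega)) le_rfl
    · have hB' : MeasurableSet[naturalFiltration μ Z (2 * t (k + 1) - 1)] B := by
        rw [← hj (k + 1)]
        exact hB
      refine Eq.trans (measureReal_congr ?_) ((hlaw k).1 B hB' x z)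
      filter_upwards [hf k] with ω hω
      refine propext (and_congr_right fun _ => ?_)
      change f k (Z (2 * t k - 1) ω) = z ↔ Z (2 * t k - 2) ω = z
      rw [hω]
    · rw [(h.brick (t k) (ht0 k)).uniform₁ x]
      have h2 : (2 : ℝ) ≤ Fintype.card (F (2 * t k - 1)) := by
        exact_mod_cast hF _ (by have := ht0 k; omega)
      exact one_div_le_one_div_of_le two_pos h2
  refine hchain.not_isStandard hjanti (fun i => ⟨(-φ i).toNat, ?_⟩)
    (ε := fun k => α (t k - 1)) (fun k => hα _ (by have := ht0 k; omega)) (fun n => ?_)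
    fun k => (hlaw k).2
  · rw [← hφ.lt_iff_lt, hj, ht]
    omega
  · refine le_trans (le_of_eq (Finset.sum_congr rfl fun k _ => ?_)) (hM n)
    rw [ht]
    congr 1
    push_cast
    ring

theorem IsBrickChain.isStandard_reindex_iff [IsProbabilityMeasure μ] (h : IsBrickChain μ Z r α)
    (hF : ∀ n ≤ 0, 2 ≤ Fintype.card (F n)) (hα : ∀ n ≤ 0, 0 ≤ α n)
    (hsum : Summable fun n : Set.Iic (0 : ℤ) => α n)
    {κ : Type*} [LinearOrder κ] {φ : κ → ℤ} (hφ : StrictMono φ) (hφ0 : ∀ d, φ d ≤ 0) :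
    IsStandard μ (reindex (naturalFiltration μ Z) φ hφ.monotone) ↔
      {n : ℤ | n ≤ 0 ∧ 2 * n - 1 ∉ Set.range φ}.Infinite := by
  refine ⟨fun hst hfin => ?_, h.isStandard_reindex hφ hφ0⟩
  exact h.not_isStandard_reindex hF hα hsum hφ hfin hst

end Main

end BackwardFiltration

/-! ### The theorem -/

open BackwardFiltration in
theorem mainTheorem2 {Ω : Type*} [MeasurableSpace Ω] (μ : Measure Ω) [IsProbabilityMeasure μ]
    (F : ℤ → Type*) [∀ n, Fintype (F n)] [∀ n, MeasurableSpace (F n)]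
    [∀ n, MeasurableSingletonClass (F n)]
    (Z : ∀ n, Ω → F n) (r : ℤ → ℕ) (α : ℤ → ℝ)
    (hZ : ∀ n ≤ 0, Measurable (Z n))
    (hF : ∀ n ≤ 0, 2 ≤ Fintype.card (F n))
    (hα : ∀ n ≤ 0, α n ∈ Set.Ioo (0 : ℝ) 1)
    (hsum : Summable (fun n : Set.Iic (0 : ℤ) => α n))
    (hindep : iIndepFun (fun n : Set.Iic (0 : ℤ) => Z (2 * (n : ℤ))) μ)
    (hbrick : ∀ n ≤ 0, IsStrongBrick μ (Z (2 * n - 2)) (Z (2 * n - 1)) (Z (2 * n))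
      (r (2 * n - 1)) (r (2 * n)) (α n)) :
    IsMarkov μ Z ∧
    IsAdicFiltration μ (naturalFiltration μ Z) r ∧
    (∀ D : Set ℤ, D ⊆ Set.Iic 0 → D.Infinite →
      (IsStandard μ (extract (naturalFiltration μ Z) D) ↔
        {n : ℤ | n ≤ 0 ∧ 2 * n - 1 ∉ D}.Infinite)) ∧
    AtThreshold μ (oddTimes (naturalFiltration μ Z)) := by
  have h : IsBrickChain μ Z r α := ⟨hZ, hindep, hbrick⟩
  have hα0 : ∀ n ≤ 0, 0 ≤ α n := fun n hn => (hα n hn).1.le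
  have hodd : StrictMono fun n : Set.Iic (0 : ℤ) => 2 * (n : ℤ) - 1 := fun a b hab => by
    have : (a : ℤ) < b := hab
    simp only
    omega
  refine ⟨h.isMarkov, h.isAdicFiltration, fun D hD _ => ?_, ?_, fun B _ => ?_⟩
  · have hiff := h.isStandard_reindex_iff hF hα0 hsum (φ := fun n : D => (n : ℤ))
      (fun _ _ hab => hab) fun d => hD d.2
    rwa [Subtype.range_coe_subtype, ofPred_mem_eq] at hiff
  · refine h.not_isStandard_reindex hF hα0 hsum hodd ?_
    convert Set.finite_empty (α := ℤ)
    refine eq_empty_of_forall_notMem fun n hn => hn.2 ⟨⟨n, hn.1⟩, rfl⟩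
  · have hiff := h.isStandard_reindex_iff hF hα0 hsum
      (φ := fun n : B => 2 * ((n : Set.Iic (0 : ℤ)) : ℤ) - 1)
      (fun _ _ hab => hodd hab) fun d => by
        have : ((d : Set.Iic (0 : ℤ)) : ℤ) ≤ 0 := d.1.2
        omega
    refine hiff.trans ?_
    -- Since `n ↦ 2n - 1` is injective, the odd times missed by the extraction correspond exactly to
    -- the points of `Bᶜ`.
    rw [← Set.infinite_image_iff (s := Bᶜ) Subtype.val_injective.injOn]
    refine iff_of_eq (congrArg Set.Infinite (Set.ext fun n => ⟨?_, ?_⟩))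
    · rintro ⟨hn, hnB⟩
      refine ⟨⟨n, hn⟩, fun hmem => hnB ⟨⟨⟨n, hn⟩, hmem⟩, rfl⟩, rfl⟩
    · rintro ⟨⟨n, hn⟩, hnB, rfl⟩
      refine ⟨hn, ?_⟩
      rintro ⟨⟨⟨k, hk⟩, hkB⟩, hkn⟩
      obtain rfl : k = n := by
        have : 2 * k - 1 = 2 * n - 1 := hkn
        omega
      exact hnB hkB
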